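/- **Setting.** Let $M=(\mathcal S,\mathcal O,\mathcal A,P,R,\gamma,\mu)$ be an infinite-horizon discounted POMDP with $0<\gamma<1$: $\mathcal S,\mathcal O,\mathcal A$ are measurable spaces with measurable singletons, $P(\cdot\mid s,a)$ is the transition kernel, $\mathcal O(\cdot\mid s)$ the observation kernel, $R(\cdot\mid s,a)$ the reward kernel, carried by a set $\mathcal R\subseteq\mathbb R$, and $\mu$ the initial distribution on $\mathcal S$. The victim follows a fixed Markov kernel $\pi(\cdot\mid o)$ on $\mathcal A$. The attacker has feasible sets $\mathcal B(s)\subseteq\mathcal S$, $\mathcal B(s,o)\subseteq\mathcal O$, $\mathcal B(s,o,a)\subseteq\mathcal A$, $\mathcal B(s,o,a,r)\subseteq\mathcal R$ and a measurable reward function $g:\mathcal S\times\mathcal A\times\mathcal R\to\mathbb R$. At time step $t=0,1,2,\dots$, with $s_0\sim\mu$, the attacker changes $s_t$ to $s_t^\dagger\in\mathcal B(s_t)$; then $o_t\sim\mathcal O(s_t^\dagger)$, which the attacker changes to $o_t^\dagger\in\mathcal B(s_t^\dagger,o_t)$; then $a_t\sim\pi(o_t^\dagger)$, which the attacker changes to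 $a_t^\dagger\in\mathcal B(s_t^\dagger,o_t^\dagger,a_t)$; then $r_t\sim R(s_t^\dagger,a_t^\dagger)$, which the attacker changes to $r_t^\dagger\in\mathcal B(s_t^\dagger,o_t^\dagger,a_t^\dagger,r_t)$; then $s_{t+1}\sim P(s_t^\dagger,a_t^\dagger)$. An attack policy $\nu$ prescribes, measurably and possibly at random, each manipulation as a function of everything that has happened so far, and plays only feasible manipulations. Its value is $V^{\pi,\nu}=\mathbb E\big[\sum_{t\ge 0}\gamma^t g(s_t^\dagger,a_t^\dagger,r_t^\dagger)\big]$, where it is assumed that $\mathbb E\big[\sum_{t\ge0}\gamma^t|g(s_t^\dagger,a_t^\dagger,r_t^\dagger)|\big]<\infty$ for every attack policy. An attack policy is optimal if its value is maximal among all attack policies. The meta-MDP $\overline M$ has state space $\mathcal S\sqcup(\mathcal S\times\mathcal O)\sqcup(\mathcal S\times\mathcal O\times\mathcal A)\sqcup(\mathcal S\times\mathcal O\times\mathcal A\times\mathcal R)$, available actions $\mathcal B(\bar s)$ at $\bar s$, and the transitions - from $s$ under $s^\dagger$ to $(s^\dagger,o)$ with $o\sim\mathcal O(s^\dagger)$,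 - from $(s,o)$ under $o^\dagger$ to $(s,o^\dagger,a)$ with $a\sim\pi(o^\dagger)$, - from $(s,o,a)$ under $a^\dagger$ to $(s,o,a^\dagger,r)$ with $r\sim R(s,a^\dagger)$, - from $(s,o,a,r)$ under $r^\dagger$ to $s'\sim P(s,a)$. Its reward is $\bar r\big((s,o,a,r),r^\dagger\big)=g(s,a,r^\dagger)$ and $0$ at all other meta-states, its discount factor is $\bar\gamma=\gamma^{1/4}$, and its initial distribution is $\mu$ on $\mathcal S$. The value of a (history-dependent, randomized) policy of $\overline M$ is $\mathbb E\big[\sum_{k\ge0}\bar\gamma^{\,k}\,\bar r(\bar s_k,\bar a_k)\big]$; $V^*_{\overline M}$ is the supremum of the values of all policies, and a policy is optimal if its value is maximal among all policies. **Proposition.** 1. The expected total discounted reward of every policy of $\overline M$ converges absolutely, and $$\sup_\nu V^{\pi,\nu}=\bar\gamma^{-3}\,V^*_{\overline M}=\gamma^{-3/4}\,V^*_{\overline M}$$ (as extended real numbers). That is, the attacker's best value equals the optimal value of $\overline M$ when the rewards of $\overline M$ are discounted from its first reward-bearing subtime, $k=3$. 2. The supremum on the left is attained by some attack policy if and only if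 $\overline M$ has an optimal policy. 3. If $\nu^*$ is a deterministic stationary policy of $\overline M$ that is optimal for $\overline M$, then the attack policy that plays $\nu^*(s_t)$, $\nu^*(s_t^\dagger,o_t)$, $\nu^*(s_t^\dagger,o_t^\dagger,a_t)$, $\nu^*(s_t^\dagger,o_t^\dagger,a_t^\dagger,r_t)$ at the four subtimes of every time step is an optimal attack policy. 4. If $\mathcal S,\mathcal O,\mathcal A,\mathcal R$ are finite and all feasible sets are non-empty, then $\overline M$ has an optimal deterministic stationary policy; in particular the suprema in 1 are maxima. -/

import Mathlib

open MeasureTheory ProbabilityTheory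
open scoped ENNReal

/-! ## Random sequences generated step by step -/

/-- The law on `ℕ → Z` of the sequence `z₀, z₁, …` in which `z_t` is drawn from
`κ t (z₀, …, z_{t-1})` (Ionescu-Tulcea). -/
noncomputable def processLaw {Z : Type*} [MeasurableSpace Z]
    (κ : ∀ t : ℕ, Kernel (Fin t → Z) Z) [∀ t, IsMarkovKernel (κ t)] : Measure (ℕ → Z) :=
  Kernel.trajMeasure (X := fun _ => Z) (κ 0 Fin.elim0)
    (fun n => (κ (n + 1)).comap
      (fun (h : (i : Finset.Iic n) → Z) (i : Fin (n + 1)) =>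
        h ⟨i.1, Finset.mem_Iic.2 (Nat.lt_succ_iff.1 i.2)⟩)
      (measurable_pi_lambda _ fun _ => measurable_pi_apply _))

/-! ## Discounted Markov decision processes -/

/-- An infinite-horizon discounted MDP with state space `X`, action space `U`, and sets
`actions x` of available actions. The values of `trans` and `reward` at pairs `(x, u)` with
`u ∉ actions x` carry no meaning. -/
structure MDP (X U : Type*) [MeasurableSpace X] [MeasurableSpace U] where
  actions : X → Set U
  trans : Kernel (X × U) X
  reward : X → U → ℝ
  discount : ℝ
  init : Measure X
  markov_trans : IsMarkovKernel trans
  measurable_reward : Measurable fun p : X × U => reward p.1 p.2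
  prob_init : IsProbabilityMeasure init

attribute [instance] MDP.markov_trans MDP.prob_init

namespace MDP

variable {X U : Type*} [MeasurableSpace X] [MeasurableSpace U]

/-- A history-dependent randomized policy: `act t` maps the past
`(x₀, u₀), …, (x_{t-1}, u_{t-1})` and the current state `x_t` to a distribution on the actions
available at `x_t`. -/
structure Policy (N : MDP X U) where
  act : ∀ t : ℕ, Kernel ((Fin t → X × U) × X) U
  markov_act : ∀ t, IsMarkovKernel (act t)
  feasible : ∀ (t : ℕ) (h : Fin t → X × U) (x : X), ∀ᵐ u ∂(act t (h, x)), u ∈ N.actions x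

attribute [instance] Policy.markov_act

/-- The distribution of the state at time `t` given the past states and actions. -/
noncomputable def stateKernel (N : MDP X U) : ∀ t : ℕ, Kernel (Fin t → X × U) X
  | 0 => Kernel.const _ N.init
  | t + 1 => N.trans.comap (fun h => h (Fin.last t)) (measurable_pi_apply _)

instance (N : MDP X U) (t : ℕ) : IsMarkovKernel (N.stateKernel t) := by
  cases t <;> (unfold stateKernel; infer_instance)

/-- The law of the sequence `(x₀, u₀), (x₁, u₁), …` of states and actions under a policy. -/
noncomputable def law (N : MDP X U) (σ : N.Policy) : Measure (ℕ → X × U) :=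
  processLaw fun t => N.stateKernel t ⊗ₖ σ.act t

/-- The total discounted reward along a trajectory. -/
noncomputable def totalReward (N : MDP X U) (ω : ℕ → X × U) : ℝ :=
  ∑' t : ℕ, N.discount ^ t * N.reward (ω t).1 (ω t).2

/-- The expected total discounted reward of a policy. -/
noncomputable def value (N : MDP X U) (σ : N.Policy) : ℝ :=
  ∫ ω, N.totalReward ω ∂(N.law σ)

/-- Under every policy the expected total discounted reward converges absolutely. -/
def WellPosed (N : MDP X U) : Prop :=
  ∀ σ : N.Policy,
    ∫⁻ ω, ∑' t : ℕ, ‖N.discount ^ t * N.reward (ω t).1 (ω t).2‖ₑ ∂(N.law σ) < ∞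

/-- The optimal value: the supremum of the values of all policies. -/
noncomputable def optValue (N : MDP X U) : EReal :=
  ⨆ σ : N.Policy, ((N.value σ : ℝ) : EReal)

/-- A policy whose value is maximal among all policies. -/
def IsOptimal (N : MDP X U) (σ : N.Policy) : Prop :=
  ∀ τ : N.Policy, N.value τ ≤ N.value σ

/-- A deterministic stationary policy. -/
structure DetPolicy (N : MDP X U) where
  choice : X → U
  measurable_choice : Measurable choice
  feasible : ∀ x, choice x ∈ N.actions x

/-- A deterministic stationary policy as a policy: at every time `t`, play `choice x_t`. -/
noncomputable def DetPolicy.toPolicy [MeasurableSingletonClass U] {N : MDP X U}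
    (f : N.DetPolicy) : N.Policy where
  act _ := Kernel.deterministic (fun p => f.choice p.2) (f.measurable_choice.comp measurable_snd)
  markov_act _ := inferInstance
  feasible t h x := by
    rw [Kernel.deterministic_apply, ae_dirac_eq]
    exact f.feasible x

end MDP

/-! ## The environment, the attacker and their interaction -/

/-- An infinite-horizon discounted POMDP with states `S`, observations `O`, actions `A`, and
reward distributions carried by the set `𝓡` of real numbers. -/
structure POMDP (S O A : Type*) [MeasurableSpace S] [MeasurableSpace O] [MeasurableSpace A]
    (𝓡 : Set ℝ) where
  trans : Kernel (S × A) S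
  obs : Kernel S O
  rew : Kernel (S × A) 𝓡
  γ : ℝ
  init : Measure S
  markov_trans : IsMarkovKernel trans
  markov_obs : IsMarkovKernel obs
  markov_rew : IsMarkovKernel rew
  γ_pos : 0 < γ
  γ_lt_one : γ < 1
  prob_init : IsProbabilityMeasure init

attribute [instance] POMDP.markov_trans POMDP.markov_obs POMDP.markov_rew POMDP.prob_init

/-- The attacker's data: its sets of feasible manipulations at the four subtimes and its reward
function `g`. -/
structure Attacker (S O A : Type*) [MeasurableSpace S] [MeasurableSpace O] [MeasurableSpace A]
    (𝓡 : Set ℝ) where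
  feasState : S → Set S
  feasObs : S → O → Set O
  feasAct : S → O → A → Set A
  feasRew : S → O → A → 𝓡 → Set 𝓡
  g : S → A → 𝓡 → ℝ
  measurable_g : Measurable fun p : S × A × 𝓡 => g p.1 p.2.1 p.2.2

section Interaction

variable {S O A : Type*} [MeasurableSpace S] [MeasurableSpace O] [MeasurableSpace A] {𝓡 : Set ℝ}

/-- Everything that happens in one time step of the attacked interaction:
`(s, s†, o, o†, a, a†, r, r†)`, bracketed to the left. -/
abbrev StepRecord (S O A : Type*) (𝓡 : Set ℝ) : Type _ :=
  ((((((S × S) × O) × O) × A) × A) × 𝓡) × 𝓡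

namespace StepRecord

/-- The manipulated state `s†`. -/
def state (z : StepRecord S O A 𝓡) : S := z.1.1.1.1.1.1.2

/-- The manipulated action `a†`. -/
def action (z : StepRecord S O A 𝓡) : A := z.1.1.2

/-- The manipulated reward `r†`. -/
def reward (z : StepRecord S O A 𝓡) : 𝓡 := z.2

end StepRecord

/-- A history-dependent randomized attack policy: at each of the four subtimes of time step `t`,
the attacker draws a manipulation that may depend on all previous time steps and on everything
that has happened in the present one, and that has to be feasible. -/
structure AttackPolicy (att : Attacker S O A 𝓡) where
  onState : ∀ t : ℕ, Kernel ((Fin t → StepRecord S O A 𝓡) × S) S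
  onObs : ∀ t : ℕ, Kernel ((Fin t → StepRecord S O A 𝓡) × ((S × S) × O)) O
  onAct : ∀ t : ℕ, Kernel ((Fin t → StepRecord S O A 𝓡) × ((((S × S) × O) × O) × A)) A
  onRew : ∀ t : ℕ,
    Kernel ((Fin t → StepRecord S O A 𝓡) × ((((((S × S) × O) × O) × A) × A) × 𝓡)) 𝓡
  markov_onState : ∀ t, IsMarkovKernel (onState t)
  markov_onObs : ∀ t, IsMarkovKernel (onObs t)
  markov_onAct : ∀ t, IsMarkovKernel (onAct t)
  markov_onRew : ∀ t, IsMarkovKernel (onRew t)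
  feasible_onState : ∀ t h s, ∀ᵐ s' ∂(onState t (h, s)), s' ∈ att.feasState s
  feasible_onObs : ∀ t h s s' o,
    ∀ᵐ o' ∂(onObs t (h, ((s, s'), o))), o' ∈ att.feasObs s' o
  feasible_onAct : ∀ t h s s' o o' a,
    ∀ᵐ a' ∂(onAct t (h, ((((s, s'), o), o'), a))), a' ∈ att.feasAct s' o' a
  feasible_onRew : ∀ t h s s' o o' a a' r,
    ∀ᵐ r' ∂(onRew t (h, ((((((s, s'), o), o'), a), a'), r))), r' ∈ att.feasRew s' o' a' r

attribute [instance] AttackPolicy.markov_onState AttackPolicy.markov_onObs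
  AttackPolicy.markov_onAct AttackPolicy.markov_onRew

/-- The distribution of the state `s_t` of the environment given the previous time steps:
`μ` for `t = 0`, and `P(s†_{t-1}, a†_{t-1})` afterwards. -/
noncomputable def POMDP.stateKernel (M : POMDP S O A 𝓡) :
    ∀ t : ℕ, Kernel (Fin t → StepRecord S O A 𝓡) S
  | 0 => Kernel.const _ M.init
  | t + 1 => M.trans.comap (fun h => ((h (Fin.last t)).state, (h (Fin.last t)).action))
      (by unfold StepRecord.state StepRecord.action; fun_prop)

instance (M : POMDP S O A 𝓡) (t : ℕ) : IsMarkovKernel (M.stateKernel t) := by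
  cases t <;> (unfold POMDP.stateKernel; infer_instance)

/-- One time step of the interaction of the victim, the attacker and the environment: in this
order, `s_t` (environment), `s†` (attacker), `o ∼ 𝒪(s†)`, `o†` (attacker), `a ∼ π(o†)` (victim),
`a†` (attacker), `r ∼ R(s†, a†)`, `r†` (attacker). -/
noncomputable def attackStep (M : POMDP S O A 𝓡) (π : Kernel O A) {att : Attacker S O A 𝓡}
    (ν : AttackPolicy att) (t : ℕ) :
    Kernel (Fin t → StepRecord S O A 𝓡) (StepRecord S O A 𝓡) :=
  M.stateKernel t ⊗ₖ ν.onState t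
    ⊗ₖ M.obs.comap (fun p => p.2.2) (by fun_prop) ⊗ₖ ν.onObs t
    ⊗ₖ π.comap (fun p => p.2.2) (by fun_prop) ⊗ₖ ν.onAct t
    ⊗ₖ M.rew.comap (fun p => (p.2.1.1.1.1.2, p.2.2)) (by fun_prop) ⊗ₖ ν.onRew t

instance (M : POMDP S O A 𝓡) (π : Kernel O A) [IsMarkovKernel π] {att : Attacker S O A 𝓡}
    (ν : AttackPolicy att) (t : ℕ) : IsMarkovKernel (attackStep M π ν t) := by
  unfold attackStep; infer_instance

/-- The law of the attacked interaction. -/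
noncomputable def attackLaw (M : POMDP S O A 𝓡) (π : Kernel O A) [IsMarkovKernel π]
    {att : Attacker S O A 𝓡} (ν : AttackPolicy att) : Measure (ℕ → StepRecord S O A 𝓡) :=
  processLaw (attackStep M π ν)

/-- The attacker's expected total discounted reward `𝔼 ∑ₜ γ^t g(s†_t, a†_t, r†_t)`. -/
noncomputable def attackValue (M : POMDP S O A 𝓡) (π : Kernel O A) [IsMarkovKernel π]
    {att : Attacker S O A 𝓡} (ν : AttackPolicy att) : ℝ :=
  ∫ ω, ∑' t : ℕ, M.γ ^ t * att.g (ω t).state (ω t).action (ω t).reward ∂(attackLaw M π ν)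

/-- Under every attack the attacker's expected total discounted reward converges absolutely. -/
def AttackWellPosed (M : POMDP S O A 𝓡) (π : Kernel O A) [IsMarkovKernel π]
    (att : Attacker S O A 𝓡) : Prop :=
  ∀ ν : AttackPolicy att,
    ∫⁻ ω, ∑' t : ℕ, ‖M.γ ^ t * att.g (ω t).state (ω t).action (ω t).reward‖ₑ
      ∂(attackLaw M π ν) < ∞

/-- The supremum of the attacker's expected total discounted reward over all attacks. -/
noncomputable def optAttackValue (M : POMDP S O A 𝓡) (π : Kernel O A) [IsMarkovKernel π]
    (att : Attacker S O A 𝓡) : EReal :=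
  ⨆ ν : AttackPolicy att, ((attackValue M π ν : ℝ) : EReal)

/-- An attack policy that solves the attack problem. -/
def IsOptimalAttack (M : POMDP S O A 𝓡) (π : Kernel O A) [IsMarkovKernel π]
    {att : Attacker S O A 𝓡} (ν : AttackPolicy att) : Prop :=
  ∀ ν' : AttackPolicy att, attackValue M π ν' ≤ attackValue M π ν

end Interaction

/-! ## The meta-MDP -/

section Meta

variable {S O A : Type*} [MeasurableSpace S] [MeasurableSpace O] [MeasurableSpace A] {𝓡 : Set ℝ}

/-- Meta-states: the disjoint union of the `s`, the `(s, o)`, the `(s, o, a)` and the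
`(s, o, a, r)`. -/
abbrev MetaState (S O A : Type*) (𝓡 : Set ℝ) : Type _ :=
  S ⊕ (S × O) ⊕ (S × O × A) ⊕ (S × O × A × 𝓡)

/-- Meta-actions: manipulated states, observations, actions and rewards. -/
abbrev MetaAction (S O A : Type*) (𝓡 : Set ℝ) : Type _ :=
  S ⊕ O ⊕ A ⊕ 𝓡

/-- The available meta-actions. -/
def metaActions (att : Attacker S O A 𝓡) : MetaState S O A 𝓡 → Set (MetaAction S O A 𝓡)
  | .inl s => (fun s' => .inl s') '' att.feasState s
  | .inr (.inl (s, o)) => (fun o' => .inr (.inl o')) '' att.feasObs s o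
  | .inr (.inr (.inl (s, o, a))) => (fun a' => .inr (.inr (.inl a'))) '' att.feasAct s o a
  | .inr (.inr (.inr (s, o, a, r))) => (fun r' => .inr (.inr (.inr r'))) '' att.feasRew s o a r

/-- The transition probabilities. The last case concerns only pairs of a meta-state and a
meta-action that is not available there; its value is irrelevant. -/
noncomputable def metaTransFun (M : POMDP S O A 𝓡) (π : Kernel O A) :
    MetaState S O A 𝓡 × MetaAction S O A 𝓡 → Measure (MetaState S O A 𝓡)
  | (.inl _, .inl s') => (M.obs s').map fun o => .inr (.inl (s', o))
  | (.inr (.inl (s, _)), .inr (.inl o')) => (π o').map fun a => .inr (.inr (.inl (s, o', a)))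
  | (.inr (.inr (.inl (s, o, _))), .inr (.inr (.inl a'))) =>
      (M.rew (s, a')).map fun r => .inr (.inr (.inr (s, o, a', r)))
  | (.inr (.inr (.inr (s, _, a, _))), .inr (.inr (.inr _))) =>
      (M.trans (s, a)).map fun s' => .inl s'
  | (x, _) => Measure.dirac x

/-- The meta-rewards. -/
def metaReward (att : Attacker S O A 𝓡) : MetaState S O A 𝓡 → MetaAction S O A 𝓡 → ℝ
  | .inr (.inr (.inr (s, _, a, _))), .inr (.inr (.inr r')) => att.g s a r'
  | _, _ => 0

theorem measurable_of_sum_prod_sum {α β γ δ ε : Type*} [MeasurableSpace α] [MeasurableSpace β]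
    [MeasurableSpace γ] [MeasurableSpace δ] [MeasurableSpace ε] {f : (α ⊕ β) × (γ ⊕ δ) → ε}
    (h₁ : Measurable fun p : α × γ => f (.inl p.1, .inl p.2))
    (h₂ : Measurable fun p : α × δ => f (.inl p.1, .inr p.2))
    (h₃ : Measurable fun p : β × γ => f (.inr p.1, .inl p.2))
    (h₄ : Measurable fun p : β × δ => f (.inr p.1, .inr p.2)) : Measurable f := by
  rw [← (MeasurableEquiv.sumProdSum α β γ δ).symm.measurable_comp_iff]
  exact measurable_fun_sum (measurable_fun_sum h₁ h₂) (measurable_fun_sum h₃ h₄)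

theorem measurable_kernel_map {α β γ δ : Type*} [MeasurableSpace α] [MeasurableSpace β]
    [MeasurableSpace γ] [MeasurableSpace δ] (κ : Kernel β γ) [IsMarkovKernel κ] {f : α → β}
    (hf : Measurable f) {G : α → γ → δ} (hG : Measurable fun p : α × γ => G p.1 p.2) :
    Measurable fun p => (κ (f p)).map (G p) := by
  refine Measure.measurable_of_measurable_coe _ fun s hs => ?_
  have h : ∀ p, ((κ (f p)).map (G p)) s
      = (κ.comap f hf) p (Prod.mk p ⁻¹' ((fun q : α × γ => G q.1 q.2) ⁻¹' s)) := fun p => by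
    exact Measure.map_apply (hG.comp measurable_prodMk_left) hs
  simp_rw [h]
  exact Kernel.measurable_kernel_prodMk_left (hG hs)

theorem measurable_of_eq_dirac {α β γ : Type*} [MeasurableSpace α] [MeasurableSpace β]
    [MeasurableSpace γ] {F : α × β → Measure γ} (f : α → γ) (hf : Measurable f)
    (hF : ∀ p, F p = Measure.dirac (f p.1)) : Measurable F := by
  rw [funext hF]
  exact Measure.measurable_dirac.comp (hf.comp measurable_fst)

theorem measurable_of_eq_zero {α : Type*} [MeasurableSpace α] {F : α → ℝ} (hF : ∀ p, F p = 0) :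
    Measurable F := by
  rw [funext hF]
  exact measurable_const

theorem measurable_metaTransFun (M : POMDP S O A 𝓡) (π : Kernel O A) [IsMarkovKernel π] :
    Measurable (metaTransFun M π) := by
  refine measurable_of_sum_prod_sum ?_ ?_ ?_ ?_
  · exact measurable_kernel_map M.obs measurable_snd
      (G := fun (p : S × S) o => (.inr (.inl (p.2, o)) : MetaState S O A 𝓡)) (by fun_prop)
  · exact measurable_of_eq_dirac (fun s => .inl s) (by fun_prop) fun ⟨_, _⟩ => rfl
  · exact measurable_of_eq_dirac (fun x => .inr x) (by fun_prop) fun ⟨x, _⟩ => by rcases x with _ | _ | _ <;> rfl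
  refine measurable_of_sum_prod_sum ?_ ?_ ?_ ?_
  · exact measurable_kernel_map π measurable_snd
      (G := fun (p : (S × O) × O) a => (.inr (.inr (.inl (p.1.1, p.2, a))) : MetaState S O A 𝓡)) (by fun_prop)
  · exact measurable_of_eq_dirac (fun s => .inr (.inl s)) (by fun_prop) fun ⟨_, _⟩ => rfl
  · exact measurable_of_eq_dirac (fun x => .inr (.inr x)) (by fun_prop) fun ⟨x, _⟩ => by rcases x with _ | _ <;> rfl
  refine measurable_of_sum_prod_sum ?_ ?_ ?_ ?_
  · exact measurable_kernel_map M.rew (f := fun p : (S × O × A) × A => (p.1.1, p.2)) (by fun_prop)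
      (G := fun p r => (.inr (.inr (.inr (p.1.1, p.1.2.1, p.2, r))) : MetaState S O A 𝓡)) (by fun_prop)
  · exact measurable_of_eq_dirac (fun s => .inr (.inr (.inl s))) (by fun_prop) fun ⟨_, _⟩ => rfl
  · exact measurable_of_eq_dirac (fun s => .inr (.inr (.inr s))) (by fun_prop) fun ⟨_, _⟩ => rfl
  · exact measurable_kernel_map M.trans
      (f := fun p : (S × O × A × 𝓡) × 𝓡 => (p.1.1, p.1.2.2.1)) (by fun_prop)
      (G := fun _ s' => (.inl s' : MetaState S O A 𝓡)) (by fun_prop)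

theorem isProbabilityMeasure_metaTransFun (M : POMDP S O A 𝓡) (π : Kernel O A)
    [IsMarkovKernel π] (p : MetaState S O A 𝓡 × MetaAction S O A 𝓡) :
    IsProbabilityMeasure (metaTransFun M π p) := by
  rcases p with ⟨s | ⟨s, o⟩ | ⟨s, o, a⟩ | ⟨s, o, a, r⟩, s' | o' | a' | r'⟩ <;>
    simp only [metaTransFun] <;>
    first
    | infer_instance
    | exact Measure.isProbabilityMeasure_map (Measurable.aemeasurable (by fun_prop))

theorem measurable_metaReward (att : Attacker S O A 𝓡) :
    Measurable fun p : MetaState S O A 𝓡 × MetaAction S O A 𝓡 => metaReward att p.1 p.2 := by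
  refine measurable_of_sum_prod_sum (measurable_of_eq_zero fun _ => rfl) (measurable_of_eq_zero fun _ => rfl)
    (measurable_of_eq_zero fun ⟨x, _⟩ => by rcases x with _ | _ | _ <;> rfl) ?_
  refine measurable_of_sum_prod_sum (measurable_of_eq_zero fun _ => rfl) (measurable_of_eq_zero fun _ => rfl)
    (measurable_of_eq_zero fun ⟨x, _⟩ => by rcases x with _ | _ <;> rfl) ?_
  refine measurable_of_sum_prod_sum (measurable_of_eq_zero fun _ => rfl) (measurable_of_eq_zero fun _ => rfl) (measurable_of_eq_zero fun _ => rfl) ?_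
  exact att.measurable_g.comp
    (f := fun p : (S × O × A × 𝓡) × 𝓡 => (p.1.1, p.1.2.2.1, p.2)) (by fun_prop)

/-- The attacker's meta-MDP for the victim policy `π`. -/
noncomputable def metaMDP (M : POMDP S O A 𝓡) (π : Kernel O A) [IsMarkovKernel π]
    (att : Attacker S O A 𝓡) : MDP (MetaState S O A 𝓡) (MetaAction S O A 𝓡) where
  actions := metaActions att
  trans := ⟨metaTransFun M π, measurable_metaTransFun M π⟩
  reward := metaReward att
  discount := M.γ ^ (1 / 4 : ℝ)
  init := M.init.map fun s => .inl s
  markov_trans := ⟨fun p => isProbabilityMeasure_metaTransFun M π p⟩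
  measurable_reward := measurable_metaReward att
  prob_init := Measure.isProbabilityMeasure_map measurable_inl.aemeasurable

instance instMeasurableSingletonClassSum {α β : Type*} [MeasurableSpace α] [MeasurableSpace β]
    [MeasurableSingletonClass α] [MeasurableSingletonClass β] :
    MeasurableSingletonClass (α ⊕ β) where
  measurableSet_singleton
    | .inl a => by
        rw [← Set.image_singleton]
        exact (measurableSet_singleton a).inl_image
    | .inr b => by
        rw [← Set.image_singleton]
        exact measurableSet_inr_image.2 (measurableSet_singleton b)

/-- The manipulations prescribed by a map from meta-states to meta-actions. The default in each
case is never used when the prescribed meta-action is available. -/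
def chosenState (f : MetaState S O A 𝓡 → MetaAction S O A 𝓡) (s : S) : S :=
  (f (.inl s)).elim id fun _ => s

def chosenObs (f : MetaState S O A 𝓡 → MetaAction S O A 𝓡) (s : S) (o : O) : O :=
  (f (.inr (.inl (s, o)))).elim (fun _ => o) fun u => u.elim id fun _ => o

def chosenAct (f : MetaState S O A 𝓡 → MetaAction S O A 𝓡) (s : S) (o : O) (a : A) : A :=
  (f (.inr (.inr (.inl (s, o, a))))).elim (fun _ => a) fun u => u.elim (fun _ => a)
    fun v => v.elim id fun _ => a

def chosenRew (f : MetaState S O A 𝓡 → MetaAction S O A 𝓡) (s : S) (o : O) (a : A) (r : 𝓡) : 𝓡 :=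
  (f (.inr (.inr (.inr (s, o, a, r))))).elim (fun _ => r) fun u => u.elim (fun _ => r)
    fun v => v.elim (fun _ => r) id

theorem measurable_sumElim_param {α β γ δ : Type*} [MeasurableSpace α] [MeasurableSpace β]
    [MeasurableSpace γ] [MeasurableSpace δ] {u : α → β ⊕ γ} (hu : Measurable u)
    {F : α → β → δ} {G : α → γ → δ} (hF : Measurable fun p : α × β => F p.1 p.2)
    (hG : Measurable fun p : α × γ => G p.1 p.2) :
    Measurable fun x => (u x).elim (F x) (G x) := by
  have h : Measurable fun p : α × (β ⊕ γ) => p.2.elim (F p.1) (G p.1) := by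
    rw [← (MeasurableEquiv.prodSumDistrib α β γ).symm.measurable_comp_iff]
    exact measurable_fun_sum hF hG
  exact h.comp (measurable_id.prodMk hu)

theorem measurable_chosenState {α : Type*} [MeasurableSpace α]
    {f : MetaState S O A 𝓡 → MetaAction S O A 𝓡} (hf : Measurable f)
    {s : α → S} (hs : Measurable s) : Measurable fun x => chosenState f (s x) :=
  measurable_sumElim_param (F := fun _ => id) (G := fun x _ => s x)
    (hf.comp (by fun_prop)) measurable_snd (by fun_prop)

theorem measurable_chosenObs {α : Type*} [MeasurableSpace α]
    {f : MetaState S O A 𝓡 → MetaAction S O A 𝓡} (hf : Measurable f)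
    {s : α → S} (hs : Measurable s) {o : α → O} (ho : Measurable o) :
    Measurable fun x => chosenObs f (s x) (o x) :=
  measurable_sumElim_param (F := fun x _ => o x) (G := fun x (u : O ⊕ A ⊕ 𝓡) => u.elim id fun _ => o x)
    (hf.comp (by fun_prop)) (by fun_prop)
    (measurable_sumElim_param (F := fun _ => id) (G := fun p _ => o p.1) measurable_snd
      measurable_snd (by fun_prop))

theorem measurable_chosenAct {α : Type*} [MeasurableSpace α]
    {f : MetaState S O A 𝓡 → MetaAction S O A 𝓡} (hf : Measurable f)
    {s : α → S} (hs : Measurable s) {o : α → O} (ho : Measurable o) {a : α → A}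
    (ha : Measurable a) : Measurable fun x => chosenAct f (s x) (o x) (a x) := by
  refine measurable_sumElim_param (u := fun x => f (.inr (.inr (.inl (s x, o x, a x)))))
    (hf.comp (by fun_prop)) (by fun_prop) ?_
  refine measurable_sumElim_param (α := α × (O ⊕ A ⊕ 𝓡)) measurable_snd
    (F := fun p _ => a p.1) (G := fun p v => v.elim id fun _ => a p.1) (by fun_prop) ?_
  exact measurable_sumElim_param (α := (α × (O ⊕ A ⊕ 𝓡)) × (A ⊕ 𝓡)) measurable_snd
    (F := fun _ => id) (G := fun p _ => a p.1.1) (by fun_prop) (by fun_prop)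

theorem measurable_chosenRew {α : Type*} [MeasurableSpace α]
    {f : MetaState S O A 𝓡 → MetaAction S O A 𝓡} (hf : Measurable f)
    {s : α → S} (hs : Measurable s) {o : α → O} (ho : Measurable o) {a : α → A}
    (ha : Measurable a) {r : α → 𝓡} (hr : Measurable r) :
    Measurable fun x => chosenRew f (s x) (o x) (a x) (r x) := by
  refine measurable_sumElim_param (u := fun x => f (.inr (.inr (.inr (s x, o x, a x, r x)))))
    (hf.comp (by fun_prop)) (by fun_prop) ?_
  refine measurable_sumElim_param (α := α × (O ⊕ A ⊕ 𝓡)) measurable_snd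
    (F := fun p _ => r p.1) (G := fun p v => v.elim (fun _ => r p.1) id) (by fun_prop) ?_
  exact measurable_sumElim_param (α := (α × (O ⊕ A ⊕ 𝓡)) × (A ⊕ 𝓡)) measurable_snd
    (F := fun p _ => r p.1.1) (G := fun _ => id) (by fun_prop) (by fun_prop)

/-- The attack policy that at each subtime plays the manipulation prescribed by a deterministic
stationary policy of the meta-MDP at the current meta-state: `s`, `(s†, o)`, `(s†, o†, a)` or
`(s†, o†, a†, r)`. -/
noncomputable def inducedAttack [MeasurableSingletonClass S] [MeasurableSingletonClass O]
    [MeasurableSingletonClass A] {M : POMDP S O A 𝓡} {π : Kernel O A} [IsMarkovKernel π]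
    {att : Attacker S O A 𝓡} (f : (metaMDP M π att).DetPolicy) : AttackPolicy att where
  onState _ := Kernel.deterministic (fun p => chosenState f.choice p.2)
    (measurable_chosenState f.measurable_choice measurable_snd)
  onObs _ := Kernel.deterministic (fun p => chosenObs f.choice p.2.1.2 p.2.2)
    (measurable_chosenObs f.measurable_choice (by fun_prop) (by fun_prop))
  onAct _ := Kernel.deterministic (fun p => chosenAct f.choice p.2.1.1.1.2 p.2.1.2 p.2.2)
    (measurable_chosenAct f.measurable_choice (by fun_prop) (by fun_prop) (by fun_prop))
  onRew _ := Kernel.deterministic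
    (fun p => chosenRew f.choice p.2.1.1.1.1.1.2 p.2.1.1.1.2 p.2.1.2 p.2.2)
    (measurable_chosenRew f.measurable_choice (by fun_prop) (by fun_prop) (by fun_prop)
      (by fun_prop))
  markov_onState _ := inferInstance
  markov_onObs _ := inferInstance
  markov_onAct _ := inferInstance
  markov_onRew _ := inferInstance
  feasible_onState t h s := by
    rw [Kernel.deterministic_apply, ae_dirac_eq]
    obtain ⟨x, hx, he⟩ := f.feasible (.inl s)
    change chosenState f.choice s ∈ att.feasState s
    unfold chosenState
    rw [← he]
    exact hx
  feasible_onObs t h s s' o := by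
    rw [Kernel.deterministic_apply, ae_dirac_eq]
    obtain ⟨x, hx, he⟩ := f.feasible (.inr (.inl (s', o)))
    change chosenObs f.choice s' o ∈ att.feasObs s' o
    unfold chosenObs
    rw [← he]
    exact hx
  feasible_onAct t h s s' o o' a := by
    rw [Kernel.deterministic_apply, ae_dirac_eq]
    obtain ⟨x, hx, he⟩ := f.feasible (.inr (.inr (.inl (s', o', a))))
    change chosenAct f.choice s' o' a ∈ att.feasAct s' o' a
    unfold chosenAct
    rw [← he]
    exact hx
  feasible_onRew t h s s' o o' a a' r := by
    rw [Kernel.deterministic_apply, ae_dirac_eq]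
    obtain ⟨x, hx, he⟩ := f.feasible (.inr (.inr (.inr (s', o', a', r))))
    change chosenRew f.choice s' o' a' r ∈ att.feasRew s' o' a' r
    unfold chosenRew
    rw [← he]
    exact hx

end Meta

/-!
The meta-MDP runs the attacked interaction at a quarter of its speed: one time step
`(s, s†, o, o†, a, a†, r, r†)` is cut into the four pairs of a meta-state and a meta-action
`(s, s†)`, `((s†, o), o†)`, `((s†, o†, a), a†)`, `((s†, o†, a†, r), r†)`. The map `metaTrajectory`
performs this cutting on whole trajectories. The proof rests on three facts.

* Call a policy `σ` of the meta-MDP and an attack policy `ν` corresponding (`Corresponds`) if they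
  draw the same manipulation after every past that the interaction can produce. Then the law of the
  meta-MDP under `σ` is the image of the law of the interaction under `ν`
  (`Corresponds.law_eq_map`): four steps of the meta-MDP integrate a function of the history
  as one time step of the interaction does, and a law on sequences is determined by its initial
  segments. The rewards of the meta-MDP sit at the subtimes `4 t + 3`, where the discount is
  `γ^(3/4) γ^t`; hence the value of `σ` is `γ^(3/4)` times the value of `ν` (`Corresponds.value_eq`).
* Every attack policy corresponds to some policy of the meta-MDP, every policy of the meta-MDP
  corresponds to some attack policy, and a deterministic stationary policy corresponds to the attack
  policy that it induces (`AttackPolicy.corresponds_toMetaPolicy`,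
  `MDP.Policy.corresponds_toAttackPolicy`, `corresponds_inducedAttack`). This is possible although
  the meta-state forgets `s`, `o` and `a`, because policies may use the history, where these are
  recorded.
* In a finite MDP, the Bellman optimality equation has a solution `W` by the contraction principle.
  The value of a policy differs from the mean of `W` under the initial distribution by the expected
  discounted sum of its advantages with respect to `W`
  (`MDP.value_eq_integral_add_tsum_advantage`), which are nonpositive for every policy and zero for
  the greedy one (`MDP.exists_isOptimal_toPolicy`).
-/

/-! ### Laws of random sequences and their initial segments -/

section ProcessLaw

variable {Z : Type*}

/-- The first `n` terms of a sequence. -/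
def initialSegment (n : ℕ) (ω : ℕ → Z) : Fin n → Z := fun i => ω i

theorem initialSegment_succ (n : ℕ) (ω : ℕ → Z) :
    initialSegment (n + 1) ω = Fin.snoc (initialSegment n ω) (ω n) := by
  funext i
  refine Fin.lastCases ?_ (fun j => ?_) i
  · simp [initialSegment]
  · simp [initialSegment]

variable [MeasurableSpace Z]

@[fun_prop]
theorem measurable_initialSegment (n : ℕ) : Measurable (initialSegment (Z := Z) n) :=
  measurable_pi_lambda _ fun _ => measurable_pi_apply _

@[fun_prop]
theorem Measurable.finSnoc {α : Type*} [MeasurableSpace α] {n : ℕ} {f : α → Fin n → Z} {g : α → Z}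
    (hf : Measurable f) (hg : Measurable g) :
    Measurable fun x => (Fin.snoc (f x) (g x) : Fin (n + 1) → Z) := by
  refine measurable_pi_lambda _ fun i => ?_
  refine Fin.lastCases ?_ (fun j => ?_) i
  · simpa using hg
  · simpa using measurable_pi_iff.1 hf j

variable (κ : ∀ t : ℕ, Kernel (Fin t → Z) Z) [∀ t, IsMarkovKernel (κ t)]

instance : IsProbabilityMeasure (processLaw κ) := by
  unfold processLaw; infer_instance

theorem map_eval_zero_trajMeasure (μ₀ : Measure Z) [IsProbabilityMeasure μ₀]
    (κ : (n : ℕ) → Kernel ((i : Finset.Iic n) → Z) Z) [∀ n, IsMarkovKernel (κ n)] :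
    (Kernel.trajMeasure (X := fun _ => Z) μ₀ κ).map (fun x => x 0) = μ₀ := by
  let e : ((i : Finset.Iic 0) → Z) → Z := fun h => h ⟨0, Finset.mem_Iic.2 le_rfl⟩
  let c : Z → ((i : Finset.Iic 0) → Z) := fun z _ => z
  have he : Measurable e := measurable_pi_apply _
  have hc : Measurable c := measurable_pi_lambda _ fun _ => measurable_id
  have hce : ⇑(MeasurableEquiv.piUnique (fun _ : Finset.Iic 0 => Z)).symm = c := by
    funext z i
    rfl
  have h : (Kernel.trajMeasure (X := fun _ => Z) μ₀ κ).map (Preorder.frestrictLe 0) =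
      μ₀.map c := by
    rw [Kernel.trajMeasure, Measure.map_comp _ _ (by fun_prop), Kernel.traj_map_frestrictLe,
      Kernel.partialTraj_self, Measure.id_comp]
    exact congrArg (fun F => μ₀.map F) hce
  change (Kernel.trajMeasure (X := fun _ => Z) μ₀ κ).map (e ∘ Preorder.frestrictLe 0) = μ₀
  rw [← Measure.map_map he (by fun_prop), h, Measure.map_map he hc]
  exact Measure.map_id

/-- The one-step disintegration of the process: the `n`-th term is drawn from `κ n` applied to the
terms before it. -/
theorem lintegral_processLaw_succ (n : ℕ) {f : (Fin (n + 1) → Z) → ℝ≥0∞} (hf : Measurable f) :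
    ∫⁻ ω, f (initialSegment (n + 1) ω) ∂(processLaw κ) =
      ∫⁻ ω, ∫⁻ z, f (Fin.snoc (initialSegment n ω) z) ∂(κ n (initialSegment n ω))
        ∂(processLaw κ) := by
  cases n with
  | zero =>
    have h0 : ∀ ω : ℕ → Z, initialSegment 0 ω = Fin.elim0 := fun ω => Subsingleton.elim _ _
    simp_rw [initialSegment_succ, h0, lintegral_const, measure_univ, mul_one]
    have := map_eval_zero_trajMeasure (κ 0 Fin.elim0)
      (fun n => (κ (n + 1)).comap
      (fun (h : (i : Finset.Iic n) → Z) (i : Fin (n + 1)) =>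
        h ⟨i.1, Finset.mem_Iic.2 (Nat.lt_succ_iff.1 i.2)⟩)
      (measurable_pi_lambda _ fun _ => measurable_pi_apply _))
    change (processLaw κ).map _ = _ at this
    conv_rhs => rw [← this]
    rw [lintegral_map (by fun_prop) (by fun_prop)]
  | succ n =>
    let e : ((i : Finset.Iic n) → Z) → (Fin (n + 1) → Z) := fun h i =>
      h ⟨i.1, Finset.mem_Iic.2 (Nat.lt_succ_iff.1 i.2)⟩
    have he : Measurable e := measurable_pi_lambda _ fun _ => measurable_pi_apply _
    have key := Kernel.map_frestrictLe_trajMeasure_compProd_eq_map_trajMeasure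
      (X := fun _ => Z) (μ₀ := κ 0 Fin.elim0) (κ := fun n => (κ (n + 1)).comap
      (fun (h : (i : Finset.Iic n) → Z) (i : Fin (n + 1)) =>
        h ⟨i.1, Finset.mem_Iic.2 (Nat.lt_succ_iff.1 i.2)⟩)
      (measurable_pi_lambda _ fun _ => measurable_pi_apply _)) (a := n)
    change (processLaw κ).map _ ⊗ₘ _ = (processLaw κ).map _ at key
    have hg : Measurable fun p : ((i : Finset.Iic n) → Z) × Z =>
        f (Fin.snoc (e p.1) p.2) := by fun_prop
    have h := congrArg (fun m => ∫⁻ p, f (Fin.snoc (e p.1) p.2) ∂m) key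
    rw [Measure.lintegral_compProd hg, lintegral_map hg (by fun_prop),
      lintegral_map (by fun_prop) (by fun_prop)] at h
    simp_rw [initialSegment_succ (n + 1)]
    exact h.symm

variable {κ}

/-- A law on sequences is determined by the laws of arbitrarily long initial segments. -/
theorem measure_ext_of_initialSegment {P Q : Measure (ℕ → Z)} [IsFiniteMeasure P]
    (h : ∀ m, ∃ n ≥ m, P.map (initialSegment n) = Q.map (initialSegment n)) : P = Q := by
  have hP : IsProjectiveLimit P (fun I : Finset ℕ => P.map I.restrict) := fun I => rfl
  have hQ : IsProjectiveLimit Q (fun I : Finset ℕ => P.map I.restrict) := fun I => by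
    obtain ⟨n, hn, he⟩ := h (I.sup id + 1)
    have hlt : ∀ i : I, i.1 < n := fun i =>
      lt_of_lt_of_le (Nat.lt_succ_of_le (Finset.le_sup (f := id) i.2)) hn
    let g : (Fin n → Z) → (I → Z) := fun w i => w ⟨i.1, hlt i⟩
    have hg : Measurable g := measurable_pi_lambda _ fun _ => measurable_pi_apply _
    have hc : I.restrict = g ∘ initialSegment (Z := Z) n := rfl
    beta_reduce
    rw [hc, ← Measure.map_map hg (by fun_prop), ← Measure.map_map hg (by fun_prop), he]
  exact hP.unique hQ

end ProcessLaw

/-! ### Optimal policies of finite discounted MDPs -/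

namespace MDP

variable {X U : Type*} [MeasurableSpace X] [MeasurableSpace U]

instance (N : MDP X U) (σ : N.Policy) : IsProbabilityMeasure (N.law σ) := by
  unfold law; infer_instance

/-- The expectation of a function of the pair `(x_k, u_k)`, computed from the conditional law of
that pair given the past. -/
theorem lintegral_law_apply (N : MDP X U) (σ : N.Policy) (k : ℕ)
    {G : (Fin k → X × U) × (X × U) → ℝ≥0∞} (hG : Measurable G) :
    ∫⁻ ω, G (initialSegment k ω, ω k) ∂(N.law σ) =
      ∫⁻ ω, ∫⁻ x, ∫⁻ u, G (initialSegment k ω, (x, u)) ∂(σ.act k (initialSegment k ω, x))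
        ∂(N.stateKernel k (initialSegment k ω)) ∂(N.law σ) := by
  have h := lintegral_processLaw_succ (fun t => N.stateKernel t ⊗ₖ σ.act t) k
    (f := fun w => G (Fin.init w, w (Fin.last k)))
    (hG.comp ((measurable_pi_lambda _ fun _ => measurable_pi_apply _).prodMk
      (measurable_pi_apply _)))
  simp only [initialSegment_succ, Fin.init_snoc, Fin.snoc_last] at h
  refine h.trans (lintegral_congr fun ω => ?_)
  exact Kernel.lintegral_compProd _ _ _ (f := fun z => G (initialSegment k ω, z)) (by fun_prop)

/-- A property that the policy guarantees at every past and state holds along almost every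
trajectory. -/
theorem ae_law_of_forall_ae (N : MDP X U) (σ : N.Policy) {T : Set (X × U)} (hT : MeasurableSet T)
    (h : ∀ k w x, ∀ᵐ u ∂(σ.act k (w, x)), (x, u) ∈ T) (k : ℕ) :
    ∀ᵐ ω ∂(N.law σ), ω k ∈ T := by
  have h0 := N.lintegral_law_apply σ k (G := fun p => Tᶜ.indicator 1 p.2)
    ((measurable_one.indicator hT.compl).comp measurable_snd)
  -- The expected number of violations at time `k` vanishes.
  have hi : ∀ w x, ∫⁻ u, Tᶜ.indicator (1 : X × U → ℝ≥0∞) (x, u) ∂(σ.act k (w, x)) = 0 :=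
    fun w x => lintegral_eq_zero_of_ae_eq_zero ((h k w x).mono fun u hu => by simp [hu])
  have h1 : ∫⁻ ω, Tᶜ.indicator (1 : X × U → ℝ≥0∞) (ω k) ∂(N.law σ) = 0 := by
    refine h0.trans ?_
    simp [hi]
  have hm : Measurable fun ω : ℕ → X × U => Tᶜ.indicator (1 : X × U → ℝ≥0∞) (ω k) :=
    (measurable_one.indicator hT.compl).comp (measurable_pi_apply k)
  rw [lintegral_eq_zero_iff hm] at h1
  filter_upwards [h1] with ω hω
  by_contra hn
  simp [hn] at hω

theorem map_law_zero (N : MDP X U) (σ : N.Policy) :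
    (N.law σ).map (fun ω => (ω 0).1) = N.init := by
  ext s hs
  have h := N.lintegral_law_apply σ 0 (G := fun p => s.indicator 1 p.2.1)
    ((measurable_one.indicator hs).comp (by fun_prop))
  simp only [lintegral_const, measure_univ, mul_one, stateKernel, Kernel.const_apply] at h
  rw [lintegral_indicator_one hs] at h
  have hm : Measurable fun ω : ℕ → X × U => (ω 0).1 := by fun_prop
  rw [← h, Measure.map_apply hm hs, ← lintegral_indicator_one (hm hs)]
  rfl

/-- The next state is drawn from the transition kernel. -/
theorem map_law_succ (N : MDP X U) (σ : N.Policy) (k : ℕ) :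
    (N.law σ).map (fun ω => (ω k, (ω (k + 1)).1)) = (N.law σ).map (fun ω => ω k) ⊗ₘ N.trans := by
  refine Measure.ext_of_lintegral _ fun f hf => ?_
  rw [lintegral_map hf (by fun_prop), Measure.lintegral_compProd hf, lintegral_map
    (by fun_prop) (by fun_prop)]
  have h := N.lintegral_law_apply σ (k + 1) (G := fun p => f (p.1 (Fin.last k), p.2.1))
    (by fun_prop)
  simp only [lintegral_const, measure_univ, mul_one, stateKernel, Kernel.comap_apply] at h
  exact h

/-- The expected advantage `r + β ∫ W dP - W` of the `k`-th step with respect to `W`. -/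
noncomputable def advantage (N : MDP X U) (W : X → ℝ) (p : X × U) : ℝ :=
  N.reward p.1 p.2 + N.discount * (∫ y, W y ∂(N.trans p)) - W p.1

/-- The performance difference formula: for bounded `W`, the value of a policy exceeds the mean of
`W` under the initial distribution by the expected total discounted advantage. -/
theorem value_eq_integral_add_tsum_advantage (N : MDP X U) (hβ : 0 ≤ N.discount)
    (hβ1 : N.discount < 1) {W : X → ℝ} (hW : Measurable W) {C : ℝ} (hWC : ∀ x, |W x| ≤ C)
    (hr : ∀ x u, |N.reward x u| ≤ C) (σ : N.Policy) :
    N.value σ = ∫ x, W x ∂N.init +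
      ∑' k : ℕ, N.discount ^ k * ∫ ω, N.advantage W (ω k) ∂(N.law σ) := by
  set β := N.discount with hβdef
  have hrm : ∀ k, Measurable fun ω : ℕ → X × U => N.reward (ω k).1 (ω k).2 := fun k =>
    N.measurable_reward.comp (measurable_pi_apply k)
  have hri : ∀ k, Integrable (fun ω : ℕ → X × U => N.reward (ω k).1 (ω k).2) (N.law σ) := fun k =>
    Integrable.of_bound (hrm k).aestronglyMeasurable C (Filter.Eventually.of_forall fun ω => hr _ _)
  have hWi : ∀ k, Integrable (fun ω : ℕ → X × U => W (ω k).1) (N.law σ) := fun k =>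
    Integrable.of_bound (hW.comp (by fun_prop)).aestronglyMeasurable C
      (Filter.Eventually.of_forall fun ω => hWC _)
  have hPm : Measurable fun p : X × U => ∫ y, W y ∂(N.trans p) :=
    (hW.stronglyMeasurable.integral_kernel (κ := N.trans)).measurable
  have hPC : ∀ p, |∫ y, W y ∂(N.trans p)| ≤ C := fun p => by
    have := norm_integral_le_of_norm_le_const (μ := N.trans p) (f := W) (C := C)
      (Filter.Eventually.of_forall hWC)
    simpa using this
  have hPi : ∀ k, Integrable (fun ω : ℕ → X × U => ∫ y, W y ∂(N.trans (ω k))) (N.law σ) := fun k =>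
    Integrable.of_bound (hPm.comp (measurable_pi_apply k)).aestronglyMeasurable C
      (Filter.Eventually.of_forall fun ω => hPC _)
  let ρ : ℕ → ℝ := fun k => ∫ ω, N.reward (ω k).1 (ω k).2 ∂(N.law σ)
  let a : ℕ → ℝ := fun k => ∫ ω, W (ω k).1 ∂(N.law σ)
  have ha0 : a 0 = ∫ x, W x ∂N.init := by
    rw [← N.map_law_zero σ, integral_map _ hW.aestronglyMeasurable]
    exact Measurable.aemeasurable (by fun_prop)
  have hasucc : ∀ k, a (k + 1) = ∫ ω, ∫ y, W y ∂(N.trans (ω k)) ∂(N.law σ) := fun k => by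
    have h1 : a (k + 1) = ∫ p, W p.2 ∂((N.law σ).map (fun ω => (ω k, (ω (k + 1)).1))) := by
      have hm : Measurable fun ω : ℕ → X × U => (ω k, (ω (k + 1)).1) := by fun_prop
      exact (integral_map hm.aemeasurable (hW.comp measurable_snd).aestronglyMeasurable).symm
    have hk : AEMeasurable (fun ω : ℕ → X × U => ω k) (N.law σ) :=
      (measurable_pi_apply k).aemeasurable
    have : IsProbabilityMeasure ((N.law σ).map (fun ω => ω k)) :=
      Measure.isProbabilityMeasure_map hk
    rw [h1, N.map_law_succ, Measure.integral_compProd, integral_map hk]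
    · exact hPm.aestronglyMeasurable
    · exact Integrable.of_bound (hW.comp measurable_snd).aestronglyMeasurable C
        (Filter.Eventually.of_forall fun ω => hWC _)
  have hadv : ∀ k, ∫ ω, N.advantage W (ω k) ∂(N.law σ) = ρ k + β * a (k + 1) - a k := fun k => by
    unfold advantage
    have h1 := integral_sub ((hri k).add ((hPi k).const_mul β)) (hWi k)
    have h2 := integral_add (hri k) ((hPi k).const_mul β)
    rw [integral_const_mul, ← hasucc] at h2
    exact h1.trans (congrArg (· - a k) h2)
  have habs : ∀ {F : (ℕ → X × U) → ℝ}, (∀ ω, |F ω| ≤ C) → |∫ ω, F ω ∂(N.law σ)| ≤ C :=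
    fun {F} hF => by
    have := norm_integral_le_of_norm_le_const (μ := N.law σ) (f := F) (C := C)
      (Filter.Eventually.of_forall hF)
    simpa using this
  have hsum : ∀ {b : ℕ → ℝ}, (∀ k, |b k| ≤ C) → Summable fun k => β ^ k * b k := fun {b} hb => by
    refine Summable.of_norm_bounded ((summable_geometric_of_lt_one hβ hβ1).mul_right C)
      fun k => ?_
    rw [norm_mul, Real.norm_of_nonneg (pow_nonneg hβ k)]
    exact mul_le_mul_of_nonneg_left (hb k) (pow_nonneg hβ k)
  have hsρ : Summable fun k => β ^ k * ρ k := hsum fun k => habs fun ω => hr _ _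
  have hsa : Summable fun k => β ^ k * a k := hsum fun k => habs fun ω => hWC _
  have hv : N.value σ = ∑' k, β ^ k * ρ k := by
    unfold value totalReward
    rw [← integral_tsum_of_summable_integral_norm]
    · simp_rw [integral_const_mul]
      rfl
    · exact fun k => (hri k).const_mul _
    · simp only [norm_mul, integral_const_mul, norm_pow, ← hβdef, Real.norm_of_nonneg hβ]
      exact hsum fun k => habs fun ω => (abs_abs _).trans_le (hr _ _)
  have hsa' := (summable_nat_add_iff 1).2 hsa
  have he : ∀ k, β ^ k * ∫ ω, N.advantage W (ω k) ∂(N.law σ) =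
      (β ^ k * ρ k + β ^ (k + 1) * a (k + 1)) - β ^ k * a k := fun k => by
    rw [hadv]; ring
  simp_rw [he]
  -- The difference of the two discounted sums of the `a k` is `-a 0`.
  rw [(hsρ.add hsa').tsum_sub hsa, hsρ.tsum_add hsa', hsa.tsum_eq_zero_add, hv, ← ha0]
  simp

/-- The Bellman optimality equation of a finite discounted MDP has a solution: it is the fixed point
of a contraction of the space of functions with the supremum norm. -/
theorem exists_bellman_solution (N : MDP X U) [Finite X] [Finite U]
    [MeasurableSingletonClass X] (hβ : 0 ≤ N.discount) (hβ1 : N.discount < 1)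
    (hne : ∀ x, (N.actions x).Nonempty) :
    ∃ W : X → ℝ, ∀ x, IsGreatest
      ((fun u => N.reward x u + N.discount * ∫ y, W y ∂(N.trans (x, u))) '' N.actions x) (W x) := by
  classical
  have := Fintype.ofFinite X
  have hmem : ∀ x, Nonempty (N.actions x) := fun x => (hne x).to_subtype
  let Q : (X → ℝ) → X → U → ℝ := fun W x u =>
    N.reward x u + N.discount * ∫ y, W y ∂(N.trans (x, u))
  let T : (X → ℝ) → X → ℝ := fun W x => ⨆ u : N.actions x, Q W x u
  have hQ : ∀ W W' x u, Q W x u ≤ Q W' x u + N.discount * dist W W' := fun W W' x u => by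
    have h : ∫ y, W y ∂(N.trans (x, u)) ≤ ∫ y, W' y ∂(N.trans (x, u)) + dist W W' := by
      have h1 : ∫ y, W y ∂(N.trans (x, u)) ≤ ∫ y, (W' y + dist W W') ∂(N.trans (x, u)) := by
        refine integral_mono .of_finite .of_finite fun y => ?_
        have := (le_abs_self _).trans (dist_le_pi_dist W W' y)
        linarith
      rwa [integral_add .of_finite .of_finite, integral_const, probReal_univ, one_smul] at h1
    have := mul_le_mul_of_nonneg_left h hβ
    simp only [Q]
    linarith
  have hT : ∀ W W' x, T W x ≤ T W' x + N.discount * dist W W' := fun W W' x =>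
    ciSup_le fun u => (hQ W W' x u).trans
      (by gcongr; exact le_ciSup (f := fun u : N.actions x => Q W' x u)
            (Set.finite_range _).bddAbove u)
  have hc : ContractingWith ⟨N.discount, hβ⟩ T := by
    refine ⟨hβ1, LipschitzWith.of_dist_le_mul fun W W' => ?_⟩
    refine (dist_pi_le_iff (mul_nonneg hβ dist_nonneg)).2 fun x => ?_
    have h1 := hT W W' x
    have h2 := hT W' W x
    rw [dist_comm] at h2
    rw [Real.dist_eq]
    exact abs_le.2 ⟨by simp; linarith, by simp; linarith⟩
  let V := ContractingWith.fixedPoint T hc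
  refine ⟨V, fun x => ?_⟩
  have hfix : T V x = V x := congrFun (ContractingWith.fixedPoint_isFixedPt hc) x
  rw [← hfix]
  refine ⟨?_, ?_⟩
  · obtain ⟨u, hu⟩ := exists_eq_ciSup_of_finite (f := fun u : N.actions x => Q V x u)
    exact ⟨u, u.2, hu⟩
  · rintro _ ⟨u, hu, rfl⟩
    exact le_ciSup (f := fun u : N.actions x => Q V x u)
      (Set.finite_range _).bddAbove ⟨u, hu⟩

/-- A finite discounted MDP has an optimal deterministic stationary policy: one that is greedy for a
solution of the Bellman optimality equation. -/
theorem exists_isOptimal_toPolicy (N : MDP X U) [Finite X] [Finite U]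
    [MeasurableSingletonClass X] [MeasurableSingletonClass U] (hβ : 0 ≤ N.discount)
    (hβ1 : N.discount < 1) (hne : ∀ x, (N.actions x).Nonempty) :
    ∃ f : N.DetPolicy, N.IsOptimal f.toPolicy := by
  obtain ⟨W, hW⟩ := N.exists_bellman_solution hβ hβ1 hne
  choose f hf hfW using fun x => (hW x).1
  have hle : ∀ x, ∀ u ∈ N.actions x, N.advantage W (x, u) ≤ 0 := fun x u hu =>
    sub_nonpos.2 ((hW x).2 ⟨u, hu, rfl⟩)
  have heq : ∀ x, N.advantage W (x, f x) = 0 := fun x => sub_eq_zero.2 (hfW x)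
  obtain ⟨C₁, hC₁⟩ := (Set.finite_range fun x => |W x|).bddAbove
  obtain ⟨C₂, hC₂⟩ := (Set.finite_range fun p : X × U => |N.reward p.1 p.2|).bddAbove
  have hv := N.value_eq_integral_add_tsum_advantage hβ hβ1 (measurable_of_finite W)
    (C := max C₁ C₂) (fun x => (hC₁ ⟨x, rfl⟩).trans (le_max_left _ _))
    (fun x u => (hC₂ ⟨(x, u), rfl⟩).trans (le_max_right _ _))
  let g : N.DetPolicy := ⟨f, measurable_of_finite f, hf⟩
  refine ⟨g, fun τ => ?_⟩
  have hτ : ∀ k, ∫ ω, N.advantage W (ω k) ∂(N.law τ) ≤ 0 := fun k =>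
    integral_nonpos_of_ae (N.ae_law_of_forall_ae τ (T := {p | N.advantage W p ≤ 0})
      (Set.toFinite _).measurableSet
      (fun k w x => (τ.feasible k w x).mono fun u hu => hle x u hu) k)
  have hg : ∀ k, ∫ ω, N.advantage W (ω k) ∂(N.law g.toPolicy) = 0 := fun k =>
    integral_eq_zero_of_ae (N.ae_law_of_forall_ae g.toPolicy (T := {p | N.advantage W p = 0})
      (Set.toFinite _).measurableSet
      (fun k w x => by
        simp only [DetPolicy.toPolicy]
        rw [Kernel.deterministic_apply, ae_dirac_eq]
        exact heq x) k)
  rw [hv τ, hv g.toPolicy]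
  simp only [hg, mul_zero, tsum_zero]
  gcongr
  exact tsum_nonpos fun k => mul_nonpos_of_nonneg_of_nonpos (pow_nonneg hβ k) (hτ k)

end MDP

/-! ### Corresponding policies and their laws -/

namespace MDP

variable {X U : Type*} [MeasurableSpace X] [MeasurableSpace U]

/-- The conditional expectation of a function of the first `k + 1` states and actions, given the
first `k` of them. -/
noncomputable def stepIntegral (N : MDP X U) (σ : N.Policy) (k : ℕ)
    (F : (Fin (k + 1) → X × U) → ℝ≥0∞) (w : Fin k → X × U) : ℝ≥0∞ :=
  ∫⁻ z, F (Fin.snoc w z) ∂((N.stateKernel k ⊗ₖ σ.act k) w)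

theorem measurable_stepIntegral (N : MDP X U) (σ : N.Policy) (k : ℕ)
    {F : (Fin (k + 1) → X × U) → ℝ≥0∞} (hF : Measurable F) :
    Measurable (N.stepIntegral σ k F) :=
  Measurable.lintegral_kernel_prod_right' (f := fun p : (Fin k → X × U) × (X × U) =>
    F (Fin.snoc p.1 p.2)) (by fun_prop)

/-- Measurability of the inner integral in `stepIntegral_eq`. -/
theorem measurable_lintegral_act (N : MDP X U) (σ : N.Policy) (k : ℕ)
    {F : (Fin (k + 1) → X × U) → ℝ≥0∞} (hF : Measurable F) (w : Fin k → X × U) :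
    Measurable fun x => ∫⁻ u, F (Fin.snoc w (x, u)) ∂(σ.act k (w, x)) :=
  Measurable.lintegral_kernel_prod_right'' (f := fun p : X × U => F (Fin.snoc w (p.1, p.2)))
    (by fun_prop)

theorem stepIntegral_eq (N : MDP X U) (σ : N.Policy) {k : ℕ}
    {F : (Fin (k + 1) → X × U) → ℝ≥0∞} (hF : Measurable F) (w : Fin k → X × U) :
    N.stepIntegral σ k F w =
      ∫⁻ x, ∫⁻ u, F (Fin.snoc w (x, u)) ∂(σ.act k (w, x)) ∂(N.stateKernel k w) :=
  Kernel.lintegral_compProd _ _ _ (f := fun z => F (Fin.snoc w z)) (by fun_prop)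

theorem lintegral_law_succ (N : MDP X U) (σ : N.Policy) (k : ℕ)
    {F : (Fin (k + 1) → X × U) → ℝ≥0∞} (hF : Measurable F) :
    ∫⁻ ω, F (initialSegment (k + 1) ω) ∂(N.law σ) =
      ∫⁻ ω, N.stepIntegral σ k F (initialSegment k ω) ∂(N.law σ) :=
  lintegral_processLaw_succ (fun t => N.stateKernel t ⊗ₖ σ.act t) k hF

theorem lintegral_law_four (N : MDP X U) (σ : N.Policy) (k : ℕ)
    {F : (Fin (k + 4) → X × U) → ℝ≥0∞} (hF : Measurable F) :
    ∫⁻ ω, F (initialSegment (k + 4) ω) ∂(N.law σ) =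
      ∫⁻ ω, N.stepIntegral σ k (N.stepIntegral σ (k + 1) (N.stepIntegral σ (k + 2)
        (N.stepIntegral σ (k + 3) F))) (initialSegment k ω) ∂(N.law σ) := by
  have h3 := N.measurable_stepIntegral σ (k + 3) hF
  have h2 := N.measurable_stepIntegral σ _ h3
  have h1 := N.measurable_stepIntegral σ _ h2
  rw [N.lintegral_law_succ σ (k + 3) hF, N.lintegral_law_succ σ _ h3, N.lintegral_law_succ σ _ h2,
    N.lintegral_law_succ σ _ h1]

end MDP

theorem Fin.eq_snoc_four {Z : Type*} {n : ℕ} {w : Fin (n + 4) → Z} {w₀ : Fin n → Z}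
    {z₀ z₁ z₂ z₃ : Z} (h : ∀ i : Fin n, w (i.castAdd 4) = w₀ i) (h₀ : w ⟨n, by omega⟩ = z₀)
    (h₁ : w ⟨n + 1, by omega⟩ = z₁) (h₂ : w ⟨n + 2, by omega⟩ = z₂)
    (h₃ : w ⟨n + 3, by omega⟩ = z₃) :
    w = Fin.snoc (α := fun _ => Z) (Fin.snoc (α := fun _ => Z) (Fin.snoc (α := fun _ => Z)
      (Fin.snoc (α := fun _ => Z) w₀ z₀) z₁) z₂) z₃ := by
  subst h₀ h₁ h₂ h₃
  obtain rfl : w₀ = fun i => w (i.castAdd 4) := funext fun i => (h i).symm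
  refine ((Fin.snoc_init_self w).symm.trans ?_)
  congr 1
  refine ((Fin.snoc_init_self _).symm.trans ?_)
  congr 1
  refine ((Fin.snoc_init_self _).symm.trans ?_)
  congr 1
  exact (Fin.snoc_init_self _).symm

section Meta

variable {S O A : Type*} {𝓡 : Set ℝ}

/-- The pair of the meta-state and the meta-action at each of the four subtimes of a time step
(the subtime `3` stands for all larger indices as well). -/
def StepRecord.metaPair (z : StepRecord S O A 𝓡) : ℕ → MetaState S O A 𝓡 × MetaAction S O A 𝓡
  | 0 => (.inl z.1.1.1.1.1.1.1, .inl z.1.1.1.1.1.1.2)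
  | 1 => (.inr (.inl (z.1.1.1.1.1.1.2, z.1.1.1.1.1.2)), .inr (.inl z.1.1.1.1.2))
  | 2 => (.inr (.inr (.inl (z.1.1.1.1.1.1.2, z.1.1.1.1.2, z.1.1.1.2))), .inr (.inr (.inl z.1.1.2)))
  | _ => (.inr (.inr (.inr (z.1.1.1.1.1.1.2, z.1.1.1.1.2, z.1.1.2, z.1.2))),
      .inr (.inr (.inr z.2)))

/-- The `4 t` meta-states and meta-actions of the first `t` time steps. -/
def metaHistory (t : ℕ) (h : Fin t → StepRecord S O A 𝓡) :
    Fin (4 * t) → MetaState S O A 𝓡 × MetaAction S O A 𝓡 :=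
  fun i => (h ⟨i / 4, by omega⟩).metaPair (i % 4)

/-- The trajectory of the meta-MDP that encodes a trajectory of the attacked interaction. -/
def metaTrajectory (ω : ℕ → StepRecord S O A 𝓡) :
    ℕ → MetaState S O A 𝓡 × MetaAction S O A 𝓡 :=
  fun k => (ω (k / 4)).metaPair (k % 4)

/-- A meta-history extended by the first subtime of a time step. -/
abbrev metaHistoryState (t : ℕ) (h : Fin t → StepRecord S O A 𝓡) (p : S × S) :
    Fin (4 * t + 1) → MetaState S O A 𝓡 × MetaAction S O A 𝓡 :=
  Fin.snoc (metaHistory t h) (.inl p.1, .inl p.2)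

/-- A meta-history extended by the first two subtimes of a time step. -/
abbrev metaHistoryObs (t : ℕ) (h : Fin t → StepRecord S O A 𝓡) (p : ((S × S) × O) × O) :
    Fin (4 * t + 2) → MetaState S O A 𝓡 × MetaAction S O A 𝓡 :=
  Fin.snoc (metaHistoryState t h p.1.1) (.inr (.inl (p.1.1.2, p.1.2)), .inr (.inl p.2))

/-- A meta-history extended by the first three subtimes of a time step. -/
abbrev metaHistoryAct (t : ℕ) (h : Fin t → StepRecord S O A 𝓡)
    (p : ((((S × S) × O) × O) × A) × A) :
    Fin (4 * t + 3) → MetaState S O A 𝓡 × MetaAction S O A 𝓡 :=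
  Fin.snoc (metaHistoryObs t h p.1.1)
    (.inr (.inr (.inl (p.1.1.1.1.2, p.1.1.2, p.1.2))), .inr (.inr (.inl p.2)))

theorem metaHistory_snoc (t : ℕ) (h : Fin t → StepRecord S O A 𝓡) (z : StepRecord S O A 𝓡) :
    metaHistory (t + 1) (Fin.snoc h z) =
      (Fin.snoc (metaHistoryAct t h z.1.1)
        (.inr (.inr (.inr (z.1.1.1.1.1.1.2, z.1.1.1.1.2, z.1.1.2, z.1.2))),
          .inr (.inr (.inr z.2))) : Fin (4 * t + 4) → _) := by
  have hlast : ∀ j, (hj : j < 4) → ∀ hlt, metaHistory (t + 1) (Fin.snoc h z) ⟨4 * t + j, hlt⟩ =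
      z.metaPair j := fun j hj hlt => by
    have h1 : (4 * t + j) / 4 = t := by omega
    have h2 : (4 * t + j) % 4 = j := by omega
    have h3 : (⟨(4 * t + j) / 4, by omega⟩ : Fin (t + 1)) = Fin.last t := Fin.ext h1
    simp only [metaHistory, h2, h3, Fin.snoc_last]
  refine Fin.eq_snoc_four (n := 4 * t) (fun i => ?_) (hlast 0 (by omega) _) (hlast 1 (by omega) _)
    (hlast 2 (by omega) _) (hlast 3 (by omega) _)
  have h3 : (⟨i.1 / 4, by omega⟩ : Fin (t + 1)) = Fin.castSucc ⟨i.1 / 4, by omega⟩ := rfl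
  change (Fin.snoc (α := fun _ => StepRecord S O A 𝓡) h z
    (⟨i.1 / 4, by omega⟩ : Fin (t + 1))).metaPair _ = _
  rw [h3, Fin.snoc_castSucc]
  rfl

variable [MeasurableSpace S] [MeasurableSpace O] [MeasurableSpace A]

@[fun_prop]
theorem StepRecord.measurable_metaPair (j : ℕ) :
    Measurable fun z : StepRecord S O A 𝓡 => z.metaPair j := by
  match j with
  | 0 | 1 | 2 | _ + 3 => unfold metaPair; fun_prop

@[fun_prop]
theorem measurable_metaHistory (t : ℕ) :
    Measurable (metaHistory (S := S) (O := O) (A := A) (𝓡 := 𝓡) t) :=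
  measurable_pi_lambda _ fun _ => (StepRecord.measurable_metaPair _).comp (measurable_pi_apply _)

@[fun_prop]
theorem measurable_metaTrajectory :
    Measurable (metaTrajectory (S := S) (O := O) (A := A) (𝓡 := 𝓡)) :=
  measurable_pi_lambda _ fun _ => (StepRecord.measurable_metaPair _).comp (measurable_pi_apply _)

@[fun_prop]
theorem measurable_metaHistoryState (t : ℕ) :
    Measurable fun q : (Fin t → StepRecord S O A 𝓡) × (S × S) => metaHistoryState t q.1 q.2 := by
  fun_prop

@[fun_prop]
theorem measurable_metaHistoryObs (t : ℕ) :
    Measurable fun q : (Fin t → StepRecord S O A 𝓡) × (((S × S) × O) × O) =>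
      metaHistoryObs t q.1 q.2 := by
  fun_prop

@[fun_prop]
theorem measurable_metaHistoryAct (t : ℕ) :
    Measurable fun q : (Fin t → StepRecord S O A 𝓡) × (((((S × S) × O) × O) × A) × A) =>
      metaHistoryAct t q.1 q.2 := by
  fun_prop

variable {M : POMDP S O A 𝓡} {π : Kernel O A} [IsMarkovKernel π] {att : Attacker S O A 𝓡}

/-- A policy of the meta-MDP and an attack policy correspond to each other when, after every past
that the attacked interaction can produce, they draw the same manipulation. -/
structure Corresponds (σ : (metaMDP M π att).Policy) (ν : AttackPolicy att) : Prop where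
  onState : ∀ t h s, σ.act (4 * t) (metaHistory t h, .inl s) = (ν.onState t (h, s)).map .inl
  onObs : ∀ t h p o, σ.act (4 * t + 1) (metaHistoryState t h p, .inr (.inl (p.2, o))) =
    (ν.onObs t (h, (p, o))).map fun o' => .inr (.inl o')
  onAct : ∀ t h p a,
    σ.act (4 * t + 2) (metaHistoryObs t h p, .inr (.inr (.inl (p.1.1.2, p.2, a)))) =
      (ν.onAct t (h, (p, a))).map fun a' => .inr (.inr (.inl a'))
  onRew : ∀ t h p r,
    σ.act (4 * t + 3) (metaHistoryAct t h p, .inr (.inr (.inr (p.1.1.1.1.2, p.1.1.2, p.2, r)))) =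
      (ν.onRew t (h, (p, r))).map fun r' => .inr (.inr (.inr r'))

/-- One time step of the interaction as an iterated integral over its eight draws. -/
theorem lintegral_attackStep (ν : AttackPolicy att) (t : ℕ) (h : Fin t → StepRecord S O A 𝓡)
    {g : StepRecord S O A 𝓡 → ℝ≥0∞} (hg : Measurable g) :
    ∫⁻ z, g z ∂(attackStep M π ν t h) =
      ∫⁻ s, ∫⁻ s', ∫⁻ o, ∫⁻ o', ∫⁻ a, ∫⁻ a', ∫⁻ r, ∫⁻ r', g (((((((s, s'), o), o'), a), a'), r), r')
        ∂(ν.onRew t (h, ((((((s, s'), o), o'), a), a'), r))) ∂(M.rew (s', a'))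
        ∂(ν.onAct t (h, ((((s, s'), o), o'), a))) ∂(π o')
        ∂(ν.onObs t (h, ((s, s'), o))) ∂(M.obs s')
        ∂(ν.onState t (h, s)) ∂(M.stateKernel t h) := by
  unfold attackStep
  rw [Kernel.lintegral_compProd _ _ _ hg]
  have h1 := hg.lintegral_kernel_prod_right'' (a := h) (η := ν.onRew t)
  rw [Kernel.lintegral_compProd _ _ _ h1]
  have h2 := h1.lintegral_kernel_prod_right'' (a := h)
    (η := M.rew.comap (fun p : (Fin t → StepRecord S O A 𝓡) × (((((S × S) × O) × O) × A) × A) =>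
      (p.2.1.1.1.1.2, p.2.2)) (by fun_prop))
  rw [Kernel.lintegral_compProd _ _ _ h2]
  have h3 := h2.lintegral_kernel_prod_right'' (a := h) (η := ν.onAct t)
  rw [Kernel.lintegral_compProd _ _ _ h3]
  have h4 := h3.lintegral_kernel_prod_right'' (a := h)
    (η := π.comap (fun p : (Fin t → StepRecord S O A 𝓡) × (((S × S) × O) × O) => p.2.2)
      (by fun_prop))
  rw [Kernel.lintegral_compProd _ _ _ h4]
  have h5 := h4.lintegral_kernel_prod_right'' (a := h) (η := ν.onObs t)
  rw [Kernel.lintegral_compProd _ _ _ h5]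
  have h6 := h5.lintegral_kernel_prod_right'' (a := h)
    (η := M.obs.comap (fun p : (Fin t → StepRecord S O A 𝓡) × (S × S) => p.2.2) (by fun_prop))
  rw [Kernel.lintegral_compProd _ _ _ h6]
  rfl

/-- For `t > 0`, the state of the environment is drawn from the last meta-state of the previous time
step, which contains `s†` and `a†`. -/
theorem stateKernel_metaMDP (t : ℕ) (h : Fin t → StepRecord S O A 𝓡) :
    (metaMDP M π att).stateKernel (4 * t) (metaHistory t h) = (M.stateKernel t h).map .inl := by
  cases t with
  | zero => rfl
  | succ t =>
    have h1 : (4 * t + 3) / 4 = t := by omega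
    have h2 : (4 * t + 3) % 4 = 3 := by omega
    have h3 : (⟨(4 * t + 3) / 4, by omega⟩ : Fin (t + 1)) = Fin.last t := Fin.ext h1
    have h4 : metaHistory (t + 1) h (Fin.last (4 * t + 3)) = (h (Fin.last t)).metaPair 3 := by
      simp only [metaHistory, Fin.val_last, h2, h3]
    change metaTransFun M π (metaHistory (t + 1) h (Fin.last (4 * t + 3))) = _
    rw [h4]
    rfl

theorem stateKernel_metaMDP_snoc (k : ℕ)
    (w : Fin k → MetaState S O A 𝓡 × MetaAction S O A 𝓡) (z) :
    (metaMDP M π att).stateKernel (k + 1) (Fin.snoc w z) = metaTransFun M π z := by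
  change metaTransFun M π (Fin.snoc (α := fun _ => _) w z (Fin.last k)) = _
  rw [Fin.snoc_last]

/-- The four parts of a time step are drawn by the meta-MDP as they are drawn in the attacked
interaction. -/
theorem Corresponds.stepIntegral_metaHistory {σ : (metaMDP M π att).Policy} {ν : AttackPolicy att}
    (hσν : Corresponds σ ν) (t : ℕ) (h : Fin t → StepRecord S O A 𝓡)
    {F : (Fin (4 * t + 1) → MetaState S O A 𝓡 × MetaAction S O A 𝓡) → ℝ≥0∞} (hF : Measurable F) :
    (metaMDP M π att).stepIntegral σ (4 * t) F (metaHistory t h) =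
      ∫⁻ s, ∫⁻ s', F (metaHistoryState t h (s, s')) ∂(ν.onState t (h, s))
        ∂(M.stateKernel t h) := by
  rw [MDP.stepIntegral_eq _ _ hF, stateKernel_metaMDP,
    lintegral_map ((metaMDP M π att).measurable_lintegral_act σ _ hF _) measurable_inl]
  simp_rw [hσν.onState]
  exact lintegral_congr fun s => lintegral_map (hF.comp (by fun_prop)) measurable_inl

theorem Corresponds.stepIntegral_metaHistoryState {σ : (metaMDP M π att).Policy}
    {ν : AttackPolicy att} (hσν : Corresponds σ ν) (t : ℕ) (h : Fin t → StepRecord S O A 𝓡)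
    (p : S × S) {F : (Fin (4 * t + 2) → MetaState S O A 𝓡 × MetaAction S O A 𝓡) → ℝ≥0∞}
    (hF : Measurable F) :
    (metaMDP M π att).stepIntegral σ (4 * t + 1) F (metaHistoryState t h p) =
      ∫⁻ o, ∫⁻ o', F (metaHistoryObs t h ((p, o), o')) ∂(ν.onObs t (h, (p, o)))
        ∂(M.obs p.2) := by
  rw [MDP.stepIntegral_eq _ _ hF, stateKernel_metaMDP_snoc]
  simp only [metaTransFun]
  rw [lintegral_map ((metaMDP M π att).measurable_lintegral_act σ _ hF _) (by fun_prop)]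
  simp_rw [hσν.onObs]
  exact lintegral_congr fun o => lintegral_map (hF.comp (by fun_prop)) (by fun_prop)

theorem Corresponds.stepIntegral_metaHistoryObs {σ : (metaMDP M π att).Policy}
    {ν : AttackPolicy att} (hσν : Corresponds σ ν) (t : ℕ) (h : Fin t → StepRecord S O A 𝓡)
    (p : ((S × S) × O) × O)
    {F : (Fin (4 * t + 3) → MetaState S O A 𝓡 × MetaAction S O A 𝓡) → ℝ≥0∞}
    (hF : Measurable F) :
    (metaMDP M π att).stepIntegral σ (4 * t + 2) F (metaHistoryObs t h p) =
      ∫⁻ a, ∫⁻ a', F (metaHistoryAct t h ((p, a), a')) ∂(ν.onAct t (h, (p, a)))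
        ∂(π p.2) := by
  rw [MDP.stepIntegral_eq _ _ hF, stateKernel_metaMDP_snoc]
  simp only [metaTransFun]
  rw [lintegral_map ((metaMDP M π att).measurable_lintegral_act σ _ hF _) (by fun_prop)]
  simp_rw [hσν.onAct]
  exact lintegral_congr fun o => lintegral_map (hF.comp (by fun_prop)) (by fun_prop)

theorem Corresponds.stepIntegral_metaHistoryAct {σ : (metaMDP M π att).Policy}
    {ν : AttackPolicy att} (hσν : Corresponds σ ν) (t : ℕ) (h : Fin t → StepRecord S O A 𝓡)
    (p : ((((S × S) × O) × O) × A) × A)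
    {F : (Fin (4 * t + 4) → MetaState S O A 𝓡 × MetaAction S O A 𝓡) → ℝ≥0∞}
    (hF : Measurable F) :
    (metaMDP M π att).stepIntegral σ (4 * t + 3) F (metaHistoryAct t h p) =
      ∫⁻ r, ∫⁻ r', F (metaHistory (t + 1) (Fin.snoc h ((p, r), r'))) ∂(ν.onRew t (h, (p, r)))
        ∂(M.rew (p.1.1.1.1.2, p.2)) := by
  simp_rw [metaHistory_snoc]
  rw [MDP.stepIntegral_eq _ _ hF, stateKernel_metaMDP_snoc]
  simp only [metaTransFun]
  rw [lintegral_map ((metaMDP M π att).measurable_lintegral_act σ _ hF _) (by fun_prop)]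
  simp_rw [hσν.onRew]
  exact lintegral_congr fun o => lintegral_map (hF.comp (by fun_prop)) (by fun_prop)

/-- Under corresponding policies, four steps of the meta-MDP amount to one time step of the attacked
interaction. -/
theorem Corresponds.stepIntegral_four {σ : (metaMDP M π att).Policy} {ν : AttackPolicy att}
    (hσν : Corresponds σ ν) (t : ℕ) (h : Fin t → StepRecord S O A 𝓡)
    {F : (Fin (4 * t + 4) → MetaState S O A 𝓡 × MetaAction S O A 𝓡) → ℝ≥0∞} (hF : Measurable F) :
    (metaMDP M π att).stepIntegral σ (4 * t)
      ((metaMDP M π att).stepIntegral σ (4 * t + 1)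
        ((metaMDP M π att).stepIntegral σ (4 * t + 2)
          ((metaMDP M π att).stepIntegral σ (4 * t + 3) F))) (metaHistory t h) =
      ∫⁻ z, F (metaHistory (t + 1) (Fin.snoc h z)) ∂(attackStep M π ν t h) := by
  have h3 := (metaMDP M π att).measurable_stepIntegral σ _ hF
  have h2 := (metaMDP M π att).measurable_stepIntegral σ _ h3
  have h1 := (metaMDP M π att).measurable_stepIntegral σ _ h2
  rw [lintegral_attackStep ν t h (g := fun z => F (metaHistory (t + 1) (Fin.snoc h z)))
    (hF.comp ((measurable_metaHistory _).comp (by fun_prop))), hσν.stepIntegral_metaHistory t h h1]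
  simp_rw [hσν.stepIntegral_metaHistoryState t h _ h2, hσν.stepIntegral_metaHistoryObs t h _ h3,
    hσν.stepIntegral_metaHistoryAct t h _ hF]

/-- Under corresponding policies, the law of the meta-MDP is the image of the law of the attacked
interaction. -/
theorem Corresponds.law_eq_map {σ : (metaMDP M π att).Policy} {ν : AttackPolicy att}
    (hσν : Corresponds σ ν) :
    (metaMDP M π att).law σ = (attackLaw M π ν).map metaTrajectory := by
  refine measure_ext_of_initialSegment fun m => ⟨4 * m, by omega, ?_⟩
  rw [Measure.map_map (by fun_prop) (by fun_prop)]
  change _ = (attackLaw M π ν).map (fun ω => metaHistory m (initialSegment m ω))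
  induction m with
  | zero =>
    have : IsProbabilityMeasure (attackLaw M π ν) := by unfold attackLaw; infer_instance
    refine Measure.ext_of_lintegral _ fun f hf => ?_
    rw [lintegral_map hf (by fun_prop), lintegral_map hf (by fun_prop)]
    -- There is only one empty history, and both laws have total mass one.
    have : IsEmpty (Fin (4 * 0)) := Fin.isEmpty
    have hc : ∀ w, f w = f isEmptyElim := fun w => congrArg f (Subsingleton.elim _ _)
    simp_rw [hc (initialSegment _ _), hc (metaHistory _ _)]
    simp
  | succ t ih =>
    refine Measure.ext_of_lintegral _ fun F hF => ?_
    have h3 := (metaMDP M π att).measurable_stepIntegral σ (4 * t + 3) hF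
    have h2 := (metaMDP M π att).measurable_stepIntegral σ _ h3
    have h1 := (metaMDP M π att).measurable_stepIntegral σ _ h2
    have h0 := (metaMDP M π att).measurable_stepIntegral σ _ h1
    rw [lintegral_map hF (by fun_prop), lintegral_map hF (by fun_prop)]
    refine (MDP.lintegral_law_four _ σ (4 * t) hF).trans ?_
    rw [← lintegral_map (f := (metaMDP M π att).stepIntegral σ (4 * t) _) h0 (by fun_prop), ih,
      lintegral_map h0 (by fun_prop)]
    simp_rw [hσν.stepIntegral_four t _ hF]
    exact (lintegral_processLaw_succ (attackStep M π ν) t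
      (f := fun w => F (metaHistory (t + 1) w)) (hF.comp (measurable_metaHistory _))).symm

end Meta

/-! ### Rewards and values under corresponding policies -/

section Values

variable {S O A : Type*} [MeasurableSpace S] [MeasurableSpace O] [MeasurableSpace A] {𝓡 : Set ℝ}
  {M : POMDP S O A 𝓡} {π : Kernel O A} [IsMarkovKernel π] {att : Attacker S O A 𝓡}

/-- Along an encoded trajectory the rewards sit at the subtimes `4 t + 3`. -/
theorem discounted_metaReward_subtime_three (ω : ℕ → StepRecord S O A 𝓡) (t : ℕ) :
    (metaMDP M π att).discount ^ (4 * t + 3) *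
        (metaMDP M π att).reward (metaTrajectory ω (4 * t + 3)).1 (metaTrajectory ω (4 * t + 3)).2 =
      M.γ ^ (3 / 4 : ℝ) * (M.γ ^ t * att.g (ω t).state (ω t).action (ω t).reward) := by
  have h1 : (4 * t + 3) / 4 = t := by omega
  have h2 : (4 * t + 3) % 4 = 3 := by omega
  have h3 : metaTrajectory ω (4 * t + 3) = (ω t).metaPair 3 := by
    simp only [metaTrajectory, h1, h2]
  have h4 : (metaMDP M π att).discount ^ (4 * t + 3) = M.γ ^ (3 / 4 : ℝ) * M.γ ^ t := by
    change (M.γ ^ (1 / 4 : ℝ)) ^ (4 * t + 3) = _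
    rw [← Real.rpow_natCast, ← Real.rpow_natCast, ← Real.rpow_mul M.γ_pos.le,
      ← Real.rpow_add M.γ_pos]
    congr 1
    push_cast
    ring
  rw [h3, h4, mul_assoc]
  rfl

theorem metaReward_eq_zero_of_notMem_range (ω : ℕ → StepRecord S O A 𝓡) {k : ℕ}
    (hk : k ∉ Set.range fun t => 4 * t + 3) :
    (metaMDP M π att).reward (metaTrajectory ω k).1 (metaTrajectory ω k).2 = 0 := by
  have hk3 : k % 4 ≠ 3 := fun h => hk ⟨k / 4, by dsimp only; omega⟩
  obtain h | h | h : k % 4 = 0 ∨ k % 4 = 1 ∨ k % 4 = 2 := by omega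
  all_goals
    simp only [metaTrajectory, h]
    rfl

theorem injective_subtime_three : Function.Injective fun t : ℕ => 4 * t + 3 :=
  fun a b h => by dsimp only at h; omega

theorem totalReward_metaTrajectory (ω : ℕ → StepRecord S O A 𝓡) :
    (metaMDP M π att).totalReward (metaTrajectory ω) =
      M.γ ^ (3 / 4 : ℝ) *
        ∑' t : ℕ, M.γ ^ t * att.g (ω t).state (ω t).action (ω t).reward := by
  unfold MDP.totalReward
  rw [← injective_subtime_three.tsum_eq, ← tsum_mul_left]
  · exact tsum_congr fun t => discounted_metaReward_subtime_three ω t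
  · refine Function.support_subset_iff'.2 fun k hk => ?_
    rw [metaReward_eq_zero_of_notMem_range ω hk, mul_zero]

theorem tsum_enorm_metaTrajectory (ω : ℕ → StepRecord S O A 𝓡) :
    ∑' k : ℕ, ‖(metaMDP M π att).discount ^ k *
        (metaMDP M π att).reward (metaTrajectory ω k).1 (metaTrajectory ω k).2‖ₑ =
      ‖M.γ ^ (3 / 4 : ℝ)‖ₑ *
        ∑' t : ℕ, ‖M.γ ^ t * att.g (ω t).state (ω t).action (ω t).reward‖ₑ := by
  rw [← injective_subtime_three.tsum_eq, ← ENNReal.tsum_mul_left]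
  · refine tsum_congr fun t => ?_
    rw [discounted_metaReward_subtime_three, enorm_mul]
  · refine Function.support_subset_iff'.2 fun k hk => ?_
    rw [metaReward_eq_zero_of_notMem_range ω hk, mul_zero, enorm_zero]

theorem Corresponds.lintegral_enorm_lt_top {σ : (metaMDP M π att).Policy} {ν : AttackPolicy att}
    (hσν : Corresponds σ ν) (hwp : AttackWellPosed M π att) :
    ∫⁻ ω, ∑' k : ℕ, ‖(metaMDP M π att).discount ^ k *
      (metaMDP M π att).reward (ω k).1 (ω k).2‖ₑ ∂((metaMDP M π att).law σ) < ∞ := by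
  have hm : Measurable fun ω : ℕ → MetaState S O A 𝓡 × MetaAction S O A 𝓡 =>
      ∑' k : ℕ, ‖(metaMDP M π att).discount ^ k *
        (metaMDP M π att).reward (ω k).1 (ω k).2‖ₑ :=
    Measurable.tsum fun k => (((metaMDP M π att).measurable_reward.comp
      (measurable_pi_apply k)).const_mul _).enorm
  rw [hσν.law_eq_map, lintegral_map hm measurable_metaTrajectory]
  simp_rw [tsum_enorm_metaTrajectory]
  rw [lintegral_const_mul' _ _ enorm_ne_top]
  exact ENNReal.mul_lt_top enorm_lt_top (hwp ν)

theorem MDP.measurable_totalReward {X U : Type*} [MeasurableSpace X] [MeasurableSpace U]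
    (N : MDP X U) : Measurable N.totalReward :=
  Measurable.tsum fun t => (N.measurable_reward.comp (measurable_pi_apply t)).const_mul _

theorem Corresponds.value_eq {σ : (metaMDP M π att).Policy} {ν : AttackPolicy att}
    (hσν : Corresponds σ ν) :
    (metaMDP M π att).value σ = M.γ ^ (3 / 4 : ℝ) * attackValue M π ν := by
  unfold MDP.value attackValue
  rw [hσν.law_eq_map, integral_map measurable_metaTrajectory.aemeasurable
    (metaMDP M π att).measurable_totalReward.aestronglyMeasurable, ← integral_const_mul]
  simp_rw [totalReward_metaTrajectory]

end Values

/-! ### Measures and kernels on sums -/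

section SumsAndProjections

theorem measurableEmbedding_inl {α β : Type*} [MeasurableSpace α] [MeasurableSpace β] :
    MeasurableEmbedding (Sum.inl : α → α ⊕ β) :=
  ⟨Sum.inl_injective, measurable_inl, fun _ hs => hs.inl_image⟩

theorem measurableEmbedding_inr {α β : Type*} [MeasurableSpace α] [MeasurableSpace β] :
    MeasurableEmbedding (Sum.inr : β → α ⊕ β) :=
  ⟨Sum.inr_injective, measurable_inr, fun _ hs => measurableSet_inr_image.2 hs⟩

theorem MeasurableEmbedding.ae_map_mem_image {α β : Type*} [MeasurableSpace α] [MeasurableSpace β]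
    {e : α → β} (he : MeasurableEmbedding e) {μ : Measure α} {B : Set α} (h : ∀ᵐ y ∂μ, y ∈ B) :
    ∀ᵐ u ∂(μ.map e), u ∈ e '' B :=
  he.ae_map_iff.2 (h.mono fun _ hy => ⟨_, hy, rfl⟩)

/-- A measure concentrated on the range of `e` is recovered from its image under a left inverse of
`e`. -/
theorem map_map_of_ae_mem_image {α β : Type*} [MeasurableSpace α] [MeasurableSpace β]
    {e : α → β} (he : Measurable e) {p : β → α} (hp : Measurable p) (hpe : ∀ y, p (e y) = y)
    {μ : Measure β} {B : Set α} (h : ∀ᵐ u ∂μ, u ∈ e '' B) : (μ.map p).map e = μ := by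
  rw [Measure.map_map he hp]
  conv_rhs => rw [← Measure.map_id (μ := μ)]
  refine Measure.map_congr (h.mono ?_)
  rintro _ ⟨y, -, rfl⟩
  simp [hpe]

/-- The set `B` need not be measurable: the statement is transferred through `e`, along which almost
everywhere statements about arbitrary sets pull back. -/
theorem ae_map_mem_of_ae_mem_image {α β : Type*} [MeasurableSpace α] [MeasurableSpace β]
    {e : α → β} (he : Measurable e) {p : β → α} (hp : Measurable p) (hpe : ∀ y, p (e y) = y)
    {μ : Measure β} {B : Set α} (h : ∀ᵐ u ∂μ, u ∈ e '' B) : ∀ᵐ y ∂(μ.map p), y ∈ B := by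
  rw [← map_map_of_ae_mem_image he hp hpe h] at h
  refine (ae_of_ae_map he.aemeasurable h).mono ?_
  rintro y ⟨y', hy', hyy'⟩
  rw [← hpe y, ← hyy', hpe]
  exact hy'

/-- A kernel defined by cases on the second component of its argument. -/
noncomputable def ProbabilityTheory.Kernel.sumCases {H α β γ : Type*} [MeasurableSpace H]
    [MeasurableSpace α] [MeasurableSpace β] [MeasurableSpace γ] (κ : Kernel (H × α) γ)
    (η : Kernel (H × β) γ) : Kernel (H × (α ⊕ β)) γ :=
  ⟨fun p => p.2.elim (fun a => κ (p.1, a)) (fun b => η (p.1, b)),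
    measurable_sumElim_param (α := H × (α ⊕ β)) (F := fun p a => κ (p.1, a))
      (G := fun p b => η (p.1, b)) measurable_snd
      (κ.measurable.comp (by fun_prop)) (η.measurable.comp (by fun_prop))⟩

instance {H α β γ : Type*} [MeasurableSpace H] [MeasurableSpace α] [MeasurableSpace β]
    [MeasurableSpace γ] (κ : Kernel (H × α) γ) (η : Kernel (H × β) γ) [IsMarkovKernel κ]
    [IsMarkovKernel η] : IsMarkovKernel (κ.sumCases η) where
  isProbabilityMeasure
    | (h, .inl a) => inferInstanceAs (IsProbabilityMeasure (κ (h, a)))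
    | (h, .inr b) => inferInstanceAs (IsProbabilityMeasure (η (h, b)))

/-! ### Projections of meta-histories -/

/-- A finite sequence, continued by an arbitrary constant. -/
noncomputable def extendSeq {Z : Type*} [Nonempty Z] {k : ℕ} (w : Fin k → Z) : ℕ → Z := fun n =>
  if h : n < k then w ⟨n, h⟩ else Classical.arbitrary Z

theorem extendSeq_of_lt {Z : Type*} [Nonempty Z] {k n : ℕ} (w : Fin k → Z) (h : n < k) :
    extendSeq w n = w ⟨n, h⟩ := dif_pos h

theorem extendSeq_snoc_self {Z : Type*} [Nonempty Z] {k : ℕ} (w : Fin k → Z) (z : Z) :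
    extendSeq (Fin.snoc (α := fun _ => Z) w z) k = z := by
  rw [extendSeq_of_lt _ (Nat.lt_succ_self k)]
  exact Fin.snoc_last (α := fun _ => Z) z w

theorem extendSeq_snoc_of_lt {Z : Type*} [Nonempty Z] {k n : ℕ} (w : Fin k → Z) (z : Z)
    (h : n < k) : extendSeq (Fin.snoc (α := fun _ => Z) w z) n = extendSeq w n := by
  rw [extendSeq_of_lt _ (h.trans (Nat.lt_succ_self k)), extendSeq_of_lt _ h]
  exact Fin.snoc_castSucc (α := fun _ => Z) z w ⟨n, h⟩

@[fun_prop]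
theorem measurable_extendSeq {Z : Type*} [Nonempty Z] [MeasurableSpace Z] {k : ℕ} :
    Measurable fun w : Fin k → Z => extendSeq w := by
  refine measurable_pi_lambda _ fun n => ?_
  unfold extendSeq
  by_cases h : n < k
  · simpa only [h, dif_pos] using measurable_pi_apply _
  · simpa only [h, dif_neg, not_false_eq_true] using measurable_const

variable {S O A : Type*} [MeasurableSpace S] [MeasurableSpace O] [MeasurableSpace A] {𝓡 : Set ℝ}

/-- The state of a meta-state of the form `s`, an arbitrary state for the other forms. -/
noncomputable def MetaState.state [Nonempty S] (x : MetaState S O A 𝓡) : S :=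
  x.elim id fun _ => Classical.arbitrary S

/-- The observation of a meta-state of the form `(s, o)`, an arbitrary observation for the other
forms. -/
noncomputable def MetaState.obs [Nonempty O] (x : MetaState S O A 𝓡) : O :=
  x.elim (fun _ => Classical.arbitrary O) fun y => y.elim Prod.snd fun _ => Classical.arbitrary O

/-- The action of a meta-state of the form `(s, o, a)`, an arbitrary action for the other forms. -/
noncomputable def MetaState.act [Nonempty A] (x : MetaState S O A 𝓡) : A :=
  x.elim (fun _ => Classical.arbitrary A) fun y => y.elim (fun _ => Classical.arbitrary A)
    fun z => z.elim (fun p => p.2.2) fun _ => Classical.arbitrary A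

/-- The reward of a meta-state of the form `(s, o, a, r)`, an arbitrary reward for the other
forms. -/
noncomputable def MetaState.rew [Nonempty 𝓡] (x : MetaState S O A 𝓡) : 𝓡 :=
  x.elim (fun _ => Classical.arbitrary 𝓡) fun y => y.elim (fun _ => Classical.arbitrary 𝓡)
    fun z => z.elim (fun _ => Classical.arbitrary 𝓡) fun p => p.2.2.2

/-- The state that a meta-action is, an arbitrary state for meta-actions of another kind. -/
noncomputable def MetaAction.state [Nonempty S] (u : MetaAction S O A 𝓡) : S :=
  u.elim id fun _ => Classical.arbitrary S

/-- The observation that a meta-action is, an arbitrary observation for meta-actions of another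
kind. -/
noncomputable def MetaAction.obs [Nonempty O] (u : MetaAction S O A 𝓡) : O :=
  u.elim (fun _ => Classical.arbitrary O) fun y => y.elim id fun _ => Classical.arbitrary O

/-- The action that a meta-action is, an arbitrary action for meta-actions of another kind. -/
noncomputable def MetaAction.act [Nonempty A] (u : MetaAction S O A 𝓡) : A :=
  u.elim (fun _ => Classical.arbitrary A) fun y => y.elim (fun _ => Classical.arbitrary A)
    fun z => z.elim id fun _ => Classical.arbitrary A

/-- The reward that a meta-action is, an arbitrary reward for meta-actions of another kind. -/
noncomputable def MetaAction.rew [Nonempty 𝓡] (u : MetaAction S O A 𝓡) : 𝓡 :=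
  u.elim (fun _ => Classical.arbitrary 𝓡) fun y => y.elim (fun _ => Classical.arbitrary 𝓡)
    fun z => z.elim (fun _ => Classical.arbitrary 𝓡) id

@[fun_prop]
theorem MetaState.measurable_state [Nonempty S] :
    Measurable (MetaState.state (S := S) (O := O) (A := A) (𝓡 := 𝓡)) :=
  measurable_fun_sum measurable_id measurable_const

@[fun_prop]
theorem MetaState.measurable_obs [Nonempty O] :
    Measurable (MetaState.obs (S := S) (O := O) (A := A) (𝓡 := 𝓡)) :=
  measurable_fun_sum measurable_const (measurable_fun_sum measurable_snd measurable_const)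

@[fun_prop]
theorem MetaState.measurable_act [Nonempty A] :
    Measurable (MetaState.act (S := S) (O := O) (A := A) (𝓡 := 𝓡)) :=
  measurable_fun_sum measurable_const (measurable_fun_sum measurable_const
    (measurable_fun_sum (measurable_snd.comp measurable_snd) measurable_const))

@[fun_prop]
theorem MetaState.measurable_rew [Nonempty 𝓡] :
    Measurable (MetaState.rew (S := S) (O := O) (A := A) (𝓡 := 𝓡)) :=
  measurable_fun_sum measurable_const (measurable_fun_sum measurable_const
    (measurable_fun_sum measurable_const
      (measurable_snd.comp (measurable_snd.comp measurable_snd))))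

@[fun_prop]
theorem MetaAction.measurable_state [Nonempty S] :
    Measurable (MetaAction.state (S := S) (O := O) (A := A) (𝓡 := 𝓡)) :=
  measurable_fun_sum measurable_id measurable_const

@[fun_prop]
theorem MetaAction.measurable_obs [Nonempty O] :
    Measurable (MetaAction.obs (S := S) (O := O) (A := A) (𝓡 := 𝓡)) :=
  measurable_fun_sum measurable_const (measurable_fun_sum measurable_id measurable_const)

@[fun_prop]
theorem MetaAction.measurable_act [Nonempty A] :
    Measurable (MetaAction.act (S := S) (O := O) (A := A) (𝓡 := 𝓡)) :=
  measurable_fun_sum measurable_const (measurable_fun_sum measurable_const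
    (measurable_fun_sum measurable_id measurable_const))

@[fun_prop]
theorem MetaAction.measurable_rew [Nonempty 𝓡] :
    Measurable (MetaAction.rew (S := S) (O := O) (A := A) (𝓡 := 𝓡)) :=
  measurable_fun_sum measurable_const (measurable_fun_sum measurable_const
    (measurable_fun_sum measurable_const measurable_id))

end SumsAndProjections

/-! ### Translating policies into each other -/

section Translation

variable {S O A : Type*} {𝓡 : Set ℝ}

section

variable [Nonempty S] [Nonempty O] [Nonempty A] [Nonempty 𝓡]

/-- The records of the first `t` time steps, read off from a sequence of meta-states and
meta-actions. -/
noncomputable def decodeHistory (t : ℕ) (w : ℕ → MetaState S O A 𝓡 × MetaAction S O A 𝓡) :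
    Fin t → StepRecord S O A 𝓡 := fun i =>
  ((((((((w (4 * i)).1.state, (w (4 * i)).2.state), (w (4 * i + 1)).1.obs),
    (w (4 * i + 1)).2.obs), (w (4 * i + 2)).1.act), (w (4 * i + 2)).2.act),
    (w (4 * i + 3)).1.rew), (w (4 * i + 3)).2.rew)

theorem decodeHistory_eq (t : ℕ) (h : Fin t → StepRecord S O A 𝓡)
    {w : ℕ → MetaState S O A 𝓡 × MetaAction S O A 𝓡}
    (hw : ∀ n, (hn : n < 4 * t) → w n = metaHistory t h ⟨n, hn⟩) : decodeHistory t w = h := by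
  funext i
  have hi : ∀ j, j < 4 → w (4 * i + j) = (h i).metaPair j := fun j hj => by
    have h1 : (4 * i.1 + j) / 4 = i := by omega
    have h2 : (4 * i.1 + j) % 4 = j := by omega
    rw [hw _ (by omega)]
    simp only [metaHistory, h1, h2]
  have h0 : w (4 * i) = _ := hi 0 (by omega)
  simp only [decodeHistory, h0, hi 1 (by omega), hi 2 (by omega), hi 3 (by omega)]
  rfl

variable [MeasurableSpace S] [MeasurableSpace O] [MeasurableSpace A]

@[fun_prop]
theorem measurable_decodeHistory (t : ℕ) :
    Measurable (decodeHistory (S := S) (O := O) (A := A) (𝓡 := 𝓡) t) := by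
  refine measurable_pi_lambda _ fun i => ?_
  unfold decodeHistory
  fun_prop

variable {M : POMDP S O A 𝓡} {π : Kernel O A} [IsMarkovKernel π] {att : Attacker S O A 𝓡}

/-- The action kernel, at time `k` of the meta-MDP, that plays the manipulations prescribed by an
attack policy for time step `t`. The present meta-state decides which of the four kernels of the
attack policy is used, so that the manipulation is feasible at every meta-state; what the present
meta-state does not tell about the past is read off from the meta-history. -/
noncomputable def metaAct (ν : AttackPolicy att) (t k : ℕ) :
    Kernel ((Fin k → MetaState S O A 𝓡 × MetaAction S O A 𝓡) × MetaState S O A 𝓡)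
      (MetaAction S O A 𝓡) :=
  Kernel.sumCases
    (((ν.onState t).comap (fun p => (decodeHistory t (extendSeq p.1), p.2))
      (by fun_prop)).map .inl) <|
  Kernel.sumCases
    (((ν.onObs t).comap (fun p => (decodeHistory t (extendSeq p.1),
      (((extendSeq p.1 (4 * t)).1.state, p.2.1), p.2.2)))
      (by fun_prop)).map fun o' => .inr (.inl o')) <|
  Kernel.sumCases
    (((ν.onAct t).comap (fun p => (decodeHistory t (extendSeq p.1),
      (((((extendSeq p.1 (4 * t)).1.state, p.2.1), (extendSeq p.1 (4 * t + 1)).1.obs),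
        p.2.2.1), p.2.2.2)))
      (by fun_prop)).map fun a' => .inr (.inr (.inl a')))
    (((ν.onRew t).comap (fun p => (decodeHistory t (extendSeq p.1),
      (((((((extendSeq p.1 (4 * t)).1.state, p.2.1), (extendSeq p.1 (4 * t + 1)).1.obs),
        p.2.2.1), (extendSeq p.1 (4 * t + 2)).1.act), p.2.2.2.1), p.2.2.2.2)))
      (by fun_prop)).map fun r' => .inr (.inr (.inr r')))

theorem metaAct_inl (ν : AttackPolicy att) (t k : ℕ) (w) (s : S) :
    metaAct ν t k (w, .inl s) = (ν.onState t (decodeHistory t (extendSeq w), s)).map .inl :=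
  Kernel.map_apply _ measurable_inl _

theorem metaAct_inr_inl (ν : AttackPolicy att) (t k : ℕ) (w) (s : S) (o : O) :
    metaAct ν t k (w, .inr (.inl (s, o))) =
      (ν.onObs t (decodeHistory t (extendSeq w), (((extendSeq w (4 * t)).1.state, s), o))).map
        fun o' => .inr (.inl o') :=
  Kernel.map_apply _ (by fun_prop) _

theorem metaAct_inr_inr_inl (ν : AttackPolicy att) (t k : ℕ) (w) (s : S) (o : O) (a : A) :
    metaAct ν t k (w, .inr (.inr (.inl (s, o, a)))) =
      (ν.onAct t (decodeHistory t (extendSeq w), (((((extendSeq w (4 * t)).1.state, s),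
        (extendSeq w (4 * t + 1)).1.obs), o), a))).map fun a' => .inr (.inr (.inl a')) :=
  Kernel.map_apply _ (by fun_prop) _

theorem metaAct_inr_inr_inr (ν : AttackPolicy att) (t k : ℕ) (w) (s : S) (o : O) (a : A) (r : 𝓡) :
    metaAct ν t k (w, .inr (.inr (.inr (s, o, a, r)))) =
      (ν.onRew t (decodeHistory t (extendSeq w), (((((((extendSeq w (4 * t)).1.state, s),
        (extendSeq w (4 * t + 1)).1.obs), o), (extendSeq w (4 * t + 2)).1.act), a), r))).map
          fun r' => .inr (.inr (.inr r')) :=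
  Kernel.map_apply _ (by fun_prop) _

instance (ν : AttackPolicy att) (t k : ℕ) : IsMarkovKernel (metaAct ν t k) where
  isProbabilityMeasure := by
    rintro ⟨w, s | ⟨s, o⟩ | ⟨s, o, a⟩ | ⟨s, o, a, r⟩⟩
    · rw [metaAct_inl]
      exact Measure.isProbabilityMeasure_map (Measurable.aemeasurable (by fun_prop))
    · rw [metaAct_inr_inl]
      exact Measure.isProbabilityMeasure_map (Measurable.aemeasurable (by fun_prop))
    · rw [metaAct_inr_inr_inl]
      exact Measure.isProbabilityMeasure_map (Measurable.aemeasurable (by fun_prop))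
    · rw [metaAct_inr_inr_inr]
      exact Measure.isProbabilityMeasure_map (Measurable.aemeasurable (by fun_prop))

/-- The policy of the meta-MDP that plays an attack policy. -/
noncomputable def AttackPolicy.toMetaPolicy (M : POMDP S O A 𝓡) (π : Kernel O A) [IsMarkovKernel π]
    (ν : AttackPolicy att) : (metaMDP M π att).Policy where
  act k := metaAct ν (k / 4) k
  markov_act k := inferInstance
  feasible k w x := by
    rcases x with s | ⟨s, o⟩ | ⟨s, o, a⟩ | ⟨s, o, a, r⟩
    · rw [metaAct_inl]
      exact measurableEmbedding_inl.ae_map_mem_image (ν.feasible_onState _ _ _)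
    · rw [metaAct_inr_inl]
      exact (measurableEmbedding_inr.comp measurableEmbedding_inl).ae_map_mem_image
        (ν.feasible_onObs _ _ _ _ _)
    · rw [metaAct_inr_inr_inl]
      exact (measurableEmbedding_inr.comp
        (measurableEmbedding_inr.comp measurableEmbedding_inl)).ae_map_mem_image
          (ν.feasible_onAct _ _ _ _ _ _ _)
    · rw [metaAct_inr_inr_inr]
      exact (measurableEmbedding_inr.comp
        (measurableEmbedding_inr.comp measurableEmbedding_inr)).ae_map_mem_image
          (ν.feasible_onRew _ _ _ _ _ _ _ _ _)

theorem AttackPolicy.corresponds_toMetaPolicy (ν : AttackPolicy att) :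
    Corresponds (ν.toMetaPolicy M π) ν := by
  constructor
  · intro t h s
    have h4 : 4 * t / 4 = t := by omega
    change metaAct ν (4 * t / 4) (4 * t) _ = _
    rw [h4, metaAct_inl, decodeHistory_eq t h fun n hn => extendSeq_of_lt _ hn]
  · intro t h p o
    have h4 : (4 * t + 1) / 4 = t := by omega
    change metaAct ν ((4 * t + 1) / 4) (4 * t + 1) _ = _
    rw [h4, metaAct_inr_inl, decodeHistory_eq t h fun n hn => by
      rw [extendSeq_snoc_of_lt _ _ hn, extendSeq_of_lt _ hn], extendSeq_snoc_self]
    rfl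
  · intro t h p a
    have h4 : (4 * t + 2) / 4 = t := by omega
    change metaAct ν ((4 * t + 2) / 4) (4 * t + 2) _ = _
    rw [h4, metaAct_inr_inr_inl, decodeHistory_eq t h fun n hn => by
      rw [extendSeq_snoc_of_lt _ _ (by omega), extendSeq_snoc_of_lt _ _ hn, extendSeq_of_lt _ hn],
      extendSeq_snoc_self, extendSeq_snoc_of_lt _ _ (by omega), extendSeq_snoc_self]
    rfl
  · intro t h p r
    have h4 : (4 * t + 3) / 4 = t := by omega
    change metaAct ν ((4 * t + 3) / 4) (4 * t + 3) _ = _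
    rw [h4, metaAct_inr_inr_inr, decodeHistory_eq t h fun n hn => by
      rw [extendSeq_snoc_of_lt _ _ (by omega), extendSeq_snoc_of_lt _ _ (by omega),
        extendSeq_snoc_of_lt _ _ hn, extendSeq_of_lt _ hn],
      extendSeq_snoc_self, extendSeq_snoc_of_lt _ _ (by omega),
      extendSeq_snoc_of_lt _ _ (by omega), extendSeq_snoc_self,
      extendSeq_snoc_of_lt _ _ (by omega), extendSeq_snoc_self]
    rfl

/-- The attack policy that plays a policy of the meta-MDP: it draws a meta-action after the encoded
past and reads off the manipulation. The default values in this reading occur with probability zero,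
because the drawn meta-action is almost surely available. -/
noncomputable def MDP.Policy.toAttackPolicy (σ : (metaMDP M π att).Policy) : AttackPolicy att where
  onState t := ((σ.act (4 * t)).comap (fun q => (metaHistory t q.1, .inl q.2))
    (by fun_prop)).map MetaAction.state
  onObs t := ((σ.act (4 * t + 1)).comap
    (fun q => (metaHistoryState t q.1 q.2.1, .inr (.inl (q.2.1.2, q.2.2))))
    (by fun_prop)).map MetaAction.obs
  onAct t := ((σ.act (4 * t + 2)).comap
    (fun q => (metaHistoryObs t q.1 q.2.1, .inr (.inr (.inl (q.2.1.1.1.2, q.2.1.2, q.2.2)))))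
    (by fun_prop)).map MetaAction.act
  onRew t := ((σ.act (4 * t + 3)).comap
    (fun q => (metaHistoryAct t q.1 q.2.1,
      .inr (.inr (.inr (q.2.1.1.1.1.1.2, q.2.1.1.1.2, q.2.1.2, q.2.2)))))
    (by fun_prop)).map MetaAction.rew
  markov_onState t := Kernel.IsMarkovKernel.map _ (by fun_prop)
  markov_onObs t := Kernel.IsMarkovKernel.map _ (by fun_prop)
  markov_onAct t := Kernel.IsMarkovKernel.map _ (by fun_prop)
  markov_onRew t := Kernel.IsMarkovKernel.map _ (by fun_prop)
  feasible_onState t h s := by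
    rw [Kernel.map_apply _ (by fun_prop)]
    exact ae_map_mem_of_ae_mem_image measurable_inl (by fun_prop) (fun _ => rfl)
      (σ.feasible _ _ (.inl s))
  feasible_onObs t h s s' o := by
    rw [Kernel.map_apply _ (by fun_prop)]
    exact ae_map_mem_of_ae_mem_image
      (e := fun o' : O => (.inr (.inl o') : MetaAction S O A 𝓡)) (by fun_prop)
      (by fun_prop) (fun _ => rfl) (σ.feasible _ _ (.inr (.inl (s', o))))
  feasible_onAct t h s s' o o' a := by
    rw [Kernel.map_apply _ (by fun_prop)]
    exact ae_map_mem_of_ae_mem_image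
      (e := fun a' : A => (.inr (.inr (.inl a')) : MetaAction S O A 𝓡)) (by fun_prop)
      (by fun_prop) (fun _ => rfl) (σ.feasible _ _ (.inr (.inr (.inl (s', o', a)))))
  feasible_onRew t h s s' o o' a a' r := by
    rw [Kernel.map_apply _ (by fun_prop)]
    exact ae_map_mem_of_ae_mem_image
      (e := fun r' : 𝓡 => (.inr (.inr (.inr r')) : MetaAction S O A 𝓡)) (by fun_prop)
      (by fun_prop) (fun _ => rfl) (σ.feasible _ _ (.inr (.inr (.inr (s', o', a', r)))))

/-- Reading off the manipulation and encoding it again changes nothing almost surely. -/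
theorem MDP.Policy.corresponds_toAttackPolicy (σ : (metaMDP M π att).Policy) :
    Corresponds σ σ.toAttackPolicy := by
  constructor
  · intro t h s
    rw [MDP.Policy.toAttackPolicy, Kernel.map_apply _ (by fun_prop)]
    exact (map_map_of_ae_mem_image measurable_inl (by fun_prop) (fun _ => rfl)
      (σ.feasible _ _ (.inl s))).symm
  · intro t h p o
    rw [MDP.Policy.toAttackPolicy, Kernel.map_apply _ (by fun_prop)]
    exact (map_map_of_ae_mem_image (by fun_prop) (by fun_prop) (fun _ => rfl)
      (σ.feasible _ _ (.inr (.inl (p.2, o))))).symm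
  · intro t h p a
    rw [MDP.Policy.toAttackPolicy, Kernel.map_apply _ (by fun_prop)]
    exact (map_map_of_ae_mem_image (by fun_prop) (by fun_prop) (fun _ => rfl)
      (σ.feasible _ _ (.inr (.inr (.inl (p.1.1.2, p.2, a)))))).symm
  · intro t h p r
    rw [MDP.Policy.toAttackPolicy, Kernel.map_apply _ (by fun_prop)]
    exact (map_map_of_ae_mem_image (by fun_prop) (by fun_prop) (fun _ => rfl)
      (σ.feasible _ _ (.inr (.inr (.inr (p.1.1.1.1.2, p.1.1.2, p.2, r)))))).symm

end

variable [MeasurableSpace S] [MeasurableSpace O] [MeasurableSpace A]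
  {M : POMDP S O A 𝓡} {π : Kernel O A} [IsMarkovKernel π] {att : Attacker S O A 𝓡}

/-- A feasible choice of `f` has the form that `chosenState` and its analogues expect, so that their
defaults do not occur. -/
theorem corresponds_inducedAttack [MeasurableSingletonClass S] [MeasurableSingletonClass O]
    [MeasurableSingletonClass A] (f : (metaMDP M π att).DetPolicy) :
    Corresponds f.toPolicy (inducedAttack f) := by
  constructor
  · intro t h s
    obtain ⟨x, -, hx⟩ := f.feasible (.inl s)
    simp only [MDP.DetPolicy.toPolicy, inducedAttack]
    rw [Kernel.deterministic_apply, Kernel.deterministic_apply, Measure.map_dirac' (by fun_prop)]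
    simp only [chosenState, ← hx]
    rfl
  · intro t h p o
    obtain ⟨x, -, hx⟩ := f.feasible (.inr (.inl (p.2, o)))
    simp only [MDP.DetPolicy.toPolicy, inducedAttack]
    rw [Kernel.deterministic_apply, Kernel.deterministic_apply, Measure.map_dirac' (by fun_prop)]
    simp only [chosenObs, ← hx]
    rfl
  · intro t h p a
    obtain ⟨x, -, hx⟩ := f.feasible (.inr (.inr (.inl (p.1.1.2, p.2, a))))
    simp only [MDP.DetPolicy.toPolicy, inducedAttack]
    rw [Kernel.deterministic_apply, Kernel.deterministic_apply, Measure.map_dirac' (by fun_prop)]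
    simp only [chosenAct, ← hx]
    rfl
  · intro t h p r
    obtain ⟨x, -, hx⟩ := f.feasible (.inr (.inr (.inr (p.1.1.1.1.2, p.1.1.2, p.2, r))))
    simp only [MDP.DetPolicy.toPolicy, inducedAttack]
    rw [Kernel.deterministic_apply, Kernel.deterministic_apply, Measure.map_dirac' (by fun_prop)]
    simp only [chosenRew, ← hx]
    rfl

end Translation

theorem mainTheorem2 {S O A : Type*} [MeasurableSpace S] [MeasurableSpace O] [MeasurableSpace A]
    [MeasurableSingletonClass S] [MeasurableSingletonClass O] [MeasurableSingletonClass A]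
    {𝓡 : Set ℝ} (M : POMDP S O A 𝓡) (π : Kernel O A) [IsMarkovKernel π]
    (att : Attacker S O A 𝓡) (hwp : AttackWellPosed M π att) :
    (metaMDP M π att).WellPosed ∧
    optAttackValue M π att =
      ((M.γ ^ (-(3 / 4) : ℝ) : ℝ) : EReal) * (metaMDP M π att).optValue ∧
    ((∃ ν : AttackPolicy att, IsOptimalAttack M π ν) ↔
      ∃ σ : (metaMDP M π att).Policy, (metaMDP M π att).IsOptimal σ) ∧
    (∀ f : (metaMDP M π att).DetPolicy,
      (metaMDP M π att).IsOptimal f.toPolicy →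
        IsOptimalAttack M π (inducedAttack f)) ∧
    (Finite S → Finite O → Finite A → Finite 𝓡 →
      (∀ s, (att.feasState s).Nonempty) → (∀ s o, (att.feasObs s o).Nonempty) →
      (∀ s o a, (att.feasAct s o a).Nonempty) → (∀ s o a r, (att.feasRew s o a r).Nonempty) →
      ∃ f : (metaMDP M π att).DetPolicy, (metaMDP M π att).IsOptimal f.toPolicy) := by
  -- The components that a translated policy reads off from a malformed history need default values;
  -- these exist because there are probability measures on the four spaces.
  have : Nonempty S := M.init.nonempty_of_neZero
  have : Nonempty O := (M.obs (Classical.arbitrary S)).nonempty_of_neZero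
  have : Nonempty A := (π (Classical.arbitrary O)).nonempty_of_neZero
  have : Nonempty 𝓡 :=
    (M.rew (Classical.arbitrary S, Classical.arbitrary A)).nonempty_of_neZero
  have hc : 0 < M.γ ^ (3 / 4 : ℝ) := Real.rpow_pos_of_pos M.γ_pos _
  have hopt : ∀ {σ : (metaMDP M π att).Policy} {ν : AttackPolicy att}, Corresponds σ ν →
      ((metaMDP M π att).IsOptimal σ ↔ IsOptimalAttack M π ν) := fun {σ ν} hσν => by
    constructor
    · intro h ν'
      have := h (ν'.toMetaPolicy M π)
      rw [hσν.value_eq, ν'.corresponds_toMetaPolicy.value_eq] at this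
      exact le_of_mul_le_mul_left this hc
    · intro h σ'
      rw [hσν.value_eq, σ'.corresponds_toAttackPolicy.value_eq]
      exact mul_le_mul_of_nonneg_left (h _) hc.le
  refine ⟨fun σ => σ.corresponds_toAttackPolicy.lintegral_enorm_lt_top hwp, ?_,
    ⟨fun ⟨ν, hν⟩ => ⟨_, (hopt ν.corresponds_toMetaPolicy).2 hν⟩,
      fun ⟨σ, hσ⟩ => ⟨_, (hopt σ.corresponds_toAttackPolicy).1 hσ⟩⟩,
    fun f hf => (hopt (corresponds_inducedAttack f)).1 hf, ?_⟩
  · have hinv : M.γ ^ (-(3 / 4) : ℝ) * M.γ ^ (3 / 4 : ℝ) = 1 := by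
      rw [← Real.rpow_add M.γ_pos]
      norm_num
    have hc' : 0 ≤ M.γ ^ (-(3 / 4) : ℝ) := Real.rpow_nonneg M.γ_pos.le _
    -- No finiteness of the suprema is needed: multiplication by `γ^(3/4)` is inverted by
    -- multiplication by `γ^(-3/4)` on all extended reals.
    refine le_antisymm (iSup_le fun ν => ?_) ?_
    · have h : attackValue M π ν =
          M.γ ^ (-(3 / 4) : ℝ) * (metaMDP M π att).value (ν.toMetaPolicy M π) := by
        rw [ν.corresponds_toMetaPolicy.value_eq, ← mul_assoc, hinv, one_mul]
      rw [h, EReal.coe_mul]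
      exact mul_le_mul_of_nonneg_left
        (le_iSup (fun σ => (((metaMDP M π att).value σ : ℝ) : EReal)) _) (by exact_mod_cast hc')
    · have h : (metaMDP M π att).optValue ≤
          ((M.γ ^ (3 / 4 : ℝ) : ℝ) : EReal) * optAttackValue M π att := by
        refine iSup_le fun σ => ?_
        rw [σ.corresponds_toAttackPolicy.value_eq, EReal.coe_mul]
        exact mul_le_mul_of_nonneg_left
          (le_iSup (fun ν => ((attackValue M π ν : ℝ) : EReal)) _) (by exact_mod_cast hc.le)
      calc _ ≤ ((M.γ ^ (-(3 / 4) : ℝ) : ℝ) : EReal) *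
            (((M.γ ^ (3 / 4 : ℝ) : ℝ) : EReal) * optAttackValue M π att) :=
          mul_le_mul_of_nonneg_left h (by exact_mod_cast hc')
        _ = optAttackValue M π att := by
          rw [← mul_assoc, ← EReal.coe_mul, hinv, EReal.coe_one, one_mul]
  · intro _ _ _ _ hS hO hA hR
    refine MDP.exists_isOptimal_toPolicy _ (Real.rpow_nonneg M.γ_pos.le _)
      (Real.rpow_lt_one M.γ_pos.le M.γ_lt_one (by norm_num)) ?_
    rintro (s | ⟨s, o⟩ | ⟨s, o, a⟩ | ⟨s, o, a, r⟩)
    · exact (hS s).image _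
    · exact (hO s o).image _
    · exact (hA s o a).image _
    · exact (hR s o a r).image _
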